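/- **Setting.** Let $d\in\mathbb N$ and let $\mathcal X,\mathcal Y$ be complex Hilbert spaces. For a word $\mathfrak a=i_1\cdots i_\ell$ in the free monoid $\mathbb F^+_d$ on $d$ letters put $|\mathfrak a|=\ell$, let $\mathfrak a^\top$ be the reversed word, and for a $d$-tuple $Z=(Z_1,\dots,Z_d)$ of complex $n\times n$ matrices put $Z^{\mathfrak a}=Z_{i_1}\cdots Z_{i_\ell}$. A *nc set* is a family $\Omega=(\Omega_n)_n$ of sets $\Omega_n\subset(\mathbb C^{n\times n})^d$ closed under direct sums. A graded function $F\colon\Omega_n\to\mathcal L(\mathcal X,\mathcal Y)^{n\times n}\cong\mathcal L(\mathcal X^n,\mathcal Y^n)$ is a *nc function* if $\alpha F(Z)=F(\widetilde Z)\alpha$ whenever $\alpha Z=\widetilde Z\alpha$. A graded kernel $K(Z,W)\colon\mathbb C^{n\times m}\to\mathcal L(\mathcal Y^m,\mathcal Y^n)$ (linear; $Z\in\Omega_n$, $W\in\Omega_m$) is a *nc kernel* if $\alpha K(Z,W)(P)\beta^*=K(\widetilde Z,\widetilde W)(\alpha P\beta^*)$ whenever $\alpha Z=\widetilde Z\alpha$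 and $\beta W=\widetilde W\beta$; it is *cp* if $K(Z,Z)(P)\succeq0$ for $P\succeq0$. Its nc reproducing kernel Hilbert space $\mathcal H(K)$ is the Hilbert space of nc functions $f\colon\Omega\to\mathcal L(\mathbb C,\mathcal Y)_{\rm nc}$ that contains all $K_{W,v,y}\colon Z\mapsto(u\mapsto K(Z,W)(uv)y)$ ($W\in\Omega_m$, $v\in\mathbb C^{1\times m}$, $y\in\mathcal Y^m$) and satisfies $\langle f,K_{W,v,y}\rangle=\langle f(W)v^*,y\rangle$. A formal kernel $\mathbf K(z,w)=\sum\mathbf K_{\mathfrak a,\mathfrak b}z^{\mathfrak a}\overline w^{\mathfrak b^\top}$ with $\mathbf K_{\mathfrak a,\mathfrak b}\in\mathcal L(\mathcal Y)$ is *positive* if $\sum_{\mathfrak a,\mathfrak b}\langle\mathbf K_{\mathfrak a,\mathfrak b}y_{\mathfrak b},y_{\mathfrak a}\rangle\ge0$ for all finitely supported families $(y_{\mathfrak a})$ in $\mathcal Y$; then $\mathcal H(\mathbf K)$ is the Hilbert space of formal power series $f=\sum f_{\mathfrak a}z^{\mathfrak a}$, $f_{\mathfrak a}\in\mathcal Y$,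 with bounded coefficient maps $\mathbf{ev}_{\mathfrak a}\colon f\mapsto f_{\mathfrak a}$ satisfying $\mathbf{ev}_{\mathfrak a}\mathbf{ev}_{\mathfrak b}^*=\mathbf K_{\mathfrak a,\mathfrak b}$. For a series $\mathbf H(z)=\sum\mathbf H_{\mathfrak a}z^{\mathfrak a}$ with $\mathbf H_{\mathfrak a}\in\mathcal L(\mathcal X,\mathcal Y)$, $\mathbf H(z)\mathbf H(w)^*$ denotes the formal kernel with coefficients $\mathbf H_{\mathfrak a}\mathbf H_{\mathfrak b}^*$. All series in $Z$ are summed as $\sum_{\ell\ge0}\sum_{|\mathfrak a|=\ell}$, in the weak operator topology; the convergence set of $\mathbf H$ is the set of all $Z$ (of all sizes) at which $\sum_{\mathfrak a}Z^{\mathfrak a}\otimes\mathbf H_{\mathfrak a}$ converges. For a nc function $F$ on $\Omega$, its Taylor coefficient at $0$ at $\mathfrak a=i_1\cdots i_\ell$ is $F_{\mathfrak a}=\Delta_R^\ell F(0,\dots,0)(e_{i_1},\dots,e_{i_\ell})$, that is, $t^{-\ell}$ times the upper right corner of $F(tN_{\mathfrak a})$, where $t\ne0$ is such that $tN_{\mathfrak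 a}\in\Omega$ and $N_{\mathfrak a}$ is the bidiagonal tuple of size $\ell+1$ with zero diagonal and superdiagonal $e_{i_1},\dots,e_{i_\ell}\in\mathbb C^d$. **Theorem.** 1. Let $\mathbf K$ be a formal positive kernel with $\mathbf K(z,w)=\mathbf H(z)\mathbf H(w)^*$, $\mathbf H_{\mathfrak a}\in\mathcal L(\mathcal X,\mathcal Y)$, let $\Omega$ be the convergence set of $\mathbf H$, $H(Z)=\sum_{\mathfrak a}Z^{\mathfrak a}\otimes\mathbf H_{\mathfrak a}$ on $\Omega$, and $K(Z,W)(P)=H(Z)(P\otimes\mathrm{id}_{\mathcal X})H(W)^*$. Then $\Omega$ is a nc set; it is the set of points at which $\sum_{\mathfrak a}Z^{\mathfrak a}\otimes f_{\mathfrak a}$ converges for all $f\in\mathcal H(\mathbf K)$; $K$ is a cp nc kernel on $\Omega$; and the map $$\Phi\colon\ \sum_{\mathfrak a}f_{\mathfrak a}z^{\mathfrak a}\ \mapsto\ \Bigl(Z\mapsto\bigl(u\mapsto\sum_{\mathfrak a}Z^{\mathfrak a}u\otimes f_{\mathfrak a}\bigr)\Bigr)$$ is a linear isometry of $\mathcal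 H(\mathbf K)$ onto $\mathcal H(K)$. 2. Conversely, let $K$ be a cp nc kernel on $\Omega$ with $K(Z,W)(P)=H(Z)(P\otimes\mathrm{id}_{\mathcal X})H(W)^*$ for a nc function $H\colon\Omega\to\mathcal L(\mathcal X,\mathcal Y)_{\rm nc}$, where either (a) $\Omega=\mathrm{Nilp}^d$ is the set of jointly nilpotent tuples ($Z^{\mathfrak a}=0$ for all sufficiently long $\mathfrak a$); put $\widetilde\Omega=\Omega$; or (b) $\Omega$ is a nc set containing $0\in\mathbb C^d$ that is finitely open (for all $Z\in\Omega_n$ and $D\in(\mathbb C^{n\times n})^d$, $Z+tD\in\Omega_n$ for small $t\in\mathbb C$), and $K$ is $I$-locally bounded along slices (for all such $Z,D$ there is $\varepsilon>0$ such that $K(Z+tD,Z+tD)(I_n)$ is defined and bounded for $|t|<\varepsilon$); put $\widetilde\Omega=\{Z\colon tZ\in\Omega\text{ for all }t\in\mathbb C,\ |t|\le1\}\subset\Omega$. Let $\mathbf H(z)=\sum_{\mathfrak a}H_{\mathfrak a}z^{\mathfrak a}$, with $H_{\mathfrak a}$ the Taylor coefficients of $H$ at $0$, and $\mathbf K(z,w)=\mathbf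 H(z)\mathbf H(w)^*$. Then $H(Z)=\sum_{\mathfrak a}Z^{\mathfrak a}\otimes H_{\mathfrak a}$ for $Z\in\widetilde\Omega$; $\mathbf K$ is a formal positive kernel; its convergence set contains $\widetilde\Omega$; and $\Phi$, with $Z$ running over $\widetilde\Omega$, is a linear isometry of $\mathcal H(\mathbf K)$ onto $\mathcal H(K|_{\widetilde\Omega\times\widetilde\Omega})$, whose inverse sends $f$ to the series of its Taylor coefficients at $0$. (In case (a) this space is $\mathcal H(K)$.) Moreover, in case (b), the map sending $f\in\mathcal H(K)$ to the series $\sum_{\mathfrak a} f_{\mathfrak a}z^{\mathfrak a}$ of its Taylor coefficients at $0$ satisfies $f(Z)u=\sum_{\mathfrak a}Z^{\mathfrak a}u\otimes f_{\mathfrak a}$ on $\widetilde\Omega$ and is a coisometry of $\mathcal H(K)$ onto $\mathcal H(\mathbf K)$; it is an isometry of $\mathcal H(K)$ onto $\mathcal H(\mathbf K)$ if every $\Omega_n$ is open and connected. -/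

import Mathlib

open scoped ComplexOrder Matrix Topology
open Filter

/-! Noncommutative (nc) sets, functions and kernels over `ℂ^d`.

The levels of a nc set are indexed by `n : ℕ`. At level `n = 0` there is a single `0 × 0` tuple and
every operator is `0`, so this level carries no information and imposes no condition. -/

/-- `X^n`, the Hilbert space direct sum of `n` copies of `X`. -/
abbrev Amp (X : Type*) (n : ℕ) : Type _ := PiLp 2 (fun _ : Fin n => X)

/-- `d`-tuples of complex `n × n` matrices, that is, `(ℂ^d)^{n × n} ≅ (ℂ^{n × n})^d`. -/
abbrev MatTuple (d n : ℕ) : Type := Fin d → Matrix (Fin n) (Fin n) ℂ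

/-- The free monoid on `d` letters; the word `i₁ i₂ ⋯ i_ℓ`, read from left to right, is the list
`[i₁, i₂, …, i_ℓ]`. -/
abbrev Word (d : ℕ) : Type := List (Fin d)

/-- A subset of the disjoint union over `n` of the spaces of `d`-tuples of `n × n` matrices, given
level by level. -/
abbrev NCDomain (d : ℕ) : Type := ∀ n : ℕ, Set (MatTuple d n)

noncomputable section Definitions

variable {d : ℕ}
variable {X : Type*} [NormedAddCommGroup X] [InnerProductSpace ℂ X]
variable {Y : Type*} [NormedAddCommGroup Y] [InnerProductSpace ℂ Y]

/-- The tensor product `A ⊗ T : X^m → Y^n` of a scalar `n × m` matrix and an operator, that is, the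
operator with block matrix `[A i j • T]`. -/
def tensorOp {n m : ℕ} (A : Matrix (Fin n) (Fin m) ℂ) (T : X →L[ℂ] Y) : Amp X m →L[ℂ] Amp Y n :=
  ((PiLp.continuousLinearEquiv 2 ℂ (fun _ : Fin n => Y)).symm :
      (Fin n → Y) →L[ℂ] Amp Y n) ∘L
    ContinuousLinearMap.pi fun i =>
      ∑ j, A i j • (T ∘L (PiLp.proj 2 (fun _ : Fin m => X) j : Amp X m →L[ℂ] X))

theorem tensorOp_apply {n m : ℕ} (A : Matrix (Fin n) (Fin m) ℂ) (T : X →L[ℂ] Y) (x : Amp X m)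
    (i : Fin n) : tensorOp A T x i = ∑ j, A i j • T (x j) := by
  simp [tensorOp]

/-- A scalar matrix acting as an operator, `A ⊗ id : X^m → X^n`. -/
def scalarOp (X : Type*) [NormedAddCommGroup X] [InnerProductSpace ℂ X] {n m : ℕ}
    (A : Matrix (Fin n) (Fin m) ℂ) : Amp X m →L[ℂ] Amp X n :=
  tensorOp A (ContinuousLinearMap.id ℂ X)

theorem scalarOp_add {n m : ℕ} (A B : Matrix (Fin n) (Fin m) ℂ) :
    scalarOp X (A + B) = scalarOp X A + scalarOp X B := by
  ext x i
  simp [scalarOp, tensorOp_apply, add_smul, Finset.sum_add_distrib]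

theorem scalarOp_smul {n m : ℕ} (c : ℂ) (A : Matrix (Fin n) (Fin m) ℂ) :
    scalarOp X (c • A) = c • scalarOp X A := by
  ext x i
  simp [scalarOp, tensorOp_apply, mul_smul, Finset.smul_sum]

/-- The `(i, j)` block of an operator `X^m → Y^n`. -/
def blockEntry {n m : ℕ} (S : Amp X m →L[ℂ] Amp Y n) (i : Fin n) (j : Fin m) : X →L[ℂ] Y :=
  (PiLp.proj 2 (fun _ : Fin n => Y) i : Amp Y n →L[ℂ] Y) ∘L S ∘L
    ((PiLp.continuousLinearEquiv 2 ℂ (fun _ : Fin m => X)).symm : (Fin m → X) →L[ℂ] Amp X m) ∘L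
    ContinuousLinearMap.single ℂ (fun _ : Fin m => X) j

theorem blockEntry_tensorOp {n m : ℕ} (A : Matrix (Fin n) (Fin m) ℂ) (T : X →L[ℂ] Y)
    (i : Fin n) (j : Fin m) : blockEntry (tensorOp A T) i j = A i j • T := by
  ext x
  simp only [blockEntry, ContinuousLinearMap.comp_apply]
  change tensorOp A T (WithLp.toLp 2 (Pi.single j x)) i = _
  rw [tensorOp_apply, Finset.sum_eq_single j]
  · simp
  · intro k _ hk
    simp [hk]
  · simp

/-- The direct sum of two tuples of matrices, taken entrywise. -/
def directSum {n m : ℕ} (Z : MatTuple d n) (W : MatTuple d m) : MatTuple d (n + m) := fun k =>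
  Matrix.reindex finSumFinEquiv finSumFinEquiv (Matrix.fromBlocks (Z k) 0 0 (W k))

/-- A nc set: closed under direct sums. -/
def IsNCSet (Ω : NCDomain d) : Prop :=
  ∀ (n m : ℕ) (Z : MatTuple d n) (W : MatTuple d m),
    Z ∈ Ω n → W ∈ Ω m → directSum Z W ∈ Ω (n + m)

/-- Graded functions from `Ω` to `L(X, Y)_nc`, with `L(X, Y)^{n × n}` identified with
`L(X^n, Y^n)`. For `X = ℂ` these are the graded functions with values in
`L(ℂ, Y)_nc`, where the value at `Z ∈ Ω_n` acts on column vectors `u ∈ ℂ^n`. -/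
abbrev NCMap (Ω : NCDomain d) (X : Type*) [NormedAddCommGroup X] [InnerProductSpace ℂ X]
    (Y : Type*) [NormedAddCommGroup Y] [InnerProductSpace ℂ Y] : Type _ :=
  ∀ n : ℕ, Ω n → (Amp X n →L[ℂ] Amp Y n)

/-- A nc function: a graded function that respects intertwinings. -/
def IsNCFunction {Ω : NCDomain d} (F : NCMap Ω X Y) : Prop :=
  ∀ (n m : ℕ) (Z : Ω n) (Z' : Ω m) (α : Matrix (Fin m) (Fin n) ℂ),
    (∀ k, α * Z.1 k = Z'.1 k * α) → scalarOp Y α ∘L F n Z = F m Z' ∘L scalarOp X α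

/-- Graded kernels on `Ω`: `K(Z, W)` is a linear map from `ℂ^{n × m}` to
`L(Y)^{n × m} ≅ L(Y^m, Y^n)`. -/
abbrev NCKernel (Ω : NCDomain d) (Y : Type*) [NormedAddCommGroup Y] [InnerProductSpace ℂ Y] :
    Type _ :=
  ∀ n m : ℕ, Ω n → Ω m → (Matrix (Fin n) (Fin m) ℂ →ₗ[ℂ] (Amp Y m →L[ℂ] Amp Y n))

/-- A nc kernel: a graded kernel that respects intertwinings. -/
def IsNCKernel {Ω : NCDomain d} (K : NCKernel Ω Y) : Prop :=
  ∀ (n n' m m' : ℕ) (Z : Ω n) (Z' : Ω n') (W : Ω m) (W' : Ω m')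
    (α : Matrix (Fin n') (Fin n) ℂ) (β : Matrix (Fin m') (Fin m) ℂ)
    (P : Matrix (Fin n) (Fin m) ℂ),
    (∀ k, α * Z.1 k = Z'.1 k * α) → (∀ k, β * W.1 k = W'.1 k * β) →
      scalarOp Y α ∘L K n m Z W P ∘L scalarOp Y βᴴ = K n' m' Z' W' (α * P * βᴴ)

/-- A completely positive nc kernel. -/
def IsCPNCKernel [CompleteSpace Y] {Ω : NCDomain d} (K : NCKernel Ω Y) : Prop :=
  IsNCKernel K ∧
    ∀ (n : ℕ) (Z : Ω n) (P : Matrix (Fin n) (Fin n) ℂ), P.PosSemidef → (K n n Z Z P).IsPositive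

/-- The kernel `K(Z, W)(P) = H(Z) (P ⊗ id) H(W)^*`. -/
def kolmogorovKernel [CompleteSpace X] [CompleteSpace Y] {Ω : NCDomain d} (H : NCMap Ω X Y) :
    NCKernel Ω Y := fun n m Z W =>
  { toFun := fun P => H n Z ∘L scalarOp X P ∘L (H m W).adjoint
    map_add' := fun P Q => by
      rw [scalarOp_add, ContinuousLinearMap.add_comp, ContinuousLinearMap.comp_add]
    map_smul' := fun c P => by
      rw [scalarOp_smul, ContinuousLinearMap.smul_comp, ContinuousLinearMap.comp_smul]
      rfl }

/-- The restriction of a graded kernel to a smaller domain. -/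
def restrictKernel {Ω Ω' : NCDomain d} (h : ∀ n, Ω' n ⊆ Ω n) (K : NCKernel Ω Y) :
    NCKernel Ω' Y := fun n m Z W => K n m ⟨Z.1, h n Z.2⟩ ⟨W.1, h m W.2⟩

/-- `𝓗`, whose elements are regarded as functions on `Ω` through `ev`, is the nc reproducing kernel
Hilbert space `H(K)` of the kernel `K`: its elements are nc functions `Ω → L(ℂ, Y)_nc`, for all
`W ∈ Ω_m`, `v ∈ ℂ^{1 × m}`, `y ∈ Y^m` the kernel element `K_{W,v,y}(Z) u = K(Z, W)(u v) y` belongs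
to it, and `⟨f, K_{W,v,y}⟩ = ⟨f(W) v^*, y⟩`. (The coefficient `C^*`-algebra is `ℂ`, whose unital
`*`-representation on a Hilbert space is the scalar multiplication.) -/
structure IsNCRKHS {Ω : NCDomain d} (K : NCKernel Ω Y) (𝓗 : Type*) [NormedAddCommGroup 𝓗]
    [InnerProductSpace ℂ 𝓗] [CompleteSpace 𝓗] (ev : 𝓗 → NCMap Ω ℂ Y) : Prop where
  ev_add : ∀ f g : 𝓗, ev (f + g) = ev f + ev g
  ev_smul : ∀ (c : ℂ) (f : 𝓗), ev (c • f) = c • ev f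
  ev_injective : Function.Injective ev
  isNCFunction : ∀ f : 𝓗, IsNCFunction (ev f)
  reproducing : ∀ (m : ℕ) (W : Ω m) (v : Fin m → ℂ) (y : Amp Y m), ∃ k : 𝓗,
    (∀ (n : ℕ) (Z : Ω n) (u : Amp ℂ n), ev k n Z u = K n m Z W (Matrix.vecMulVec u v) y) ∧
    ∀ f : 𝓗, inner ℂ k f = inner ℂ y (ev f m W (WithLp.toLp 2 (star v)))

/-! Formal power series and formal kernels. -/

/-- Formal power series `∑ f_a z^a` in `d` freely noncommuting indeterminates, as the family of
their coefficients. -/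
abbrev FormalSeries (d : ℕ) (E : Type*) : Type _ := Word d → E

/-- Formal kernels `∑ K_{a,b} z^a w̄^{bᵀ}` with coefficients in `L(Y)`, where `bᵀ` is the reversed
word, as the family of their coefficients `K_{a,b}`. -/
abbrev FormalKernel (d : ℕ) (Y : Type*) [NormedAddCommGroup Y] [InnerProductSpace ℂ Y] : Type _ :=
  Matrix (Word d) (Word d) (Y →L[ℂ] Y)

/-- A positive formal kernel: `∑_{a,b} ⟨K_{a,b} y_b, y_a⟩ ≥ 0` (inner product linear in its first
argument) for all finitely supported families `y`. -/
def IsPositiveFormalKernel (Kf : FormalKernel d Y) : Prop :=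
  ∀ y : Word d →₀ Y, 0 ≤ y.sum fun a ya => y.sum fun b yb => inner ℂ ya (Kf a b yb)

/-- The formal kernel `Hf(z) Hf(w)^*`, with coefficients `K_{a,b} = H_a H_b^*`. -/
def formalKolmogorov [CompleteSpace X] [CompleteSpace Y] (Hf : FormalSeries d (X →L[ℂ] Y)) :
    FormalKernel d Y := fun a b => Hf a ∘L (Hf b).adjoint

/-- The value `Z^a = Z_{i₁} ⋯ Z_{i_ℓ}` of the monomial of the word `a = i₁ ⋯ i_ℓ`. -/
def wordEval {n : ℕ} (Z : MatTuple d n) (a : Word d) : Matrix (Fin n) (Fin n) ℂ := (a.map Z).prod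

/-- The partial sum `∑_{ℓ < N} ∑_{|a| = ℓ} Z^a ⊗ T_a` of the series of `T` at `Z`. -/
def partialSum {n : ℕ} (Z : MatTuple d n) (T : FormalSeries d (X →L[ℂ] Y)) (N : ℕ) :
    Amp X n →L[ℂ] Amp Y n :=
  ∑ ℓ ∈ Finset.range N, ∑ a : Fin ℓ → Fin d,
    tensorOp (wordEval Z (List.ofFn a)) (T (List.ofFn a))

/-- The series `∑_ℓ ∑_{|a| = ℓ} Z^a ⊗ T_a` converges to `S` in the weak operator topology. -/
def HasSeriesSum {n : ℕ} (Z : MatTuple d n) (T : FormalSeries d (X →L[ℂ] Y))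
    (S : Amp X n →L[ℂ] Amp Y n) : Prop :=
  Tendsto (fun N => ContinuousLinearMapWOT.ofCLM (partialSum Z T N)) atTop
    (𝓝 (ContinuousLinearMapWOT.ofCLM S))

open Classical in
/-- The sum of the series `∑_ℓ ∑_{|a| = ℓ} Z^a ⊗ T_a` (and `0` if it does not converge). -/
def seriesSum {n : ℕ} (Z : MatTuple d n) (T : FormalSeries d (X →L[ℂ] Y)) :
    Amp X n →L[ℂ] Amp Y n :=
  if h : ∃ S, HasSeriesSum Z T S then h.choose else 0

/-- The convergence set of a formal series with operator coefficients. -/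
def convSet (Hf : FormalSeries d (X →L[ℂ] Y)) : NCDomain d := fun _ =>
  {Z | ∃ S, HasSeriesSum Z Hf S}

/-- The nc function `Z ↦ H(Z) = ∑_ℓ ∑_{|a| = ℓ} Z^a ⊗ H_a` on the convergence set of `Hf`. -/
def sumMap (Hf : FormalSeries d (X →L[ℂ] Y)) : NCMap (convSet Hf) X Y := fun _ Z =>
  seriesSum Z.1 Hf

/-- A series with coefficients `f_a ∈ Y` as a series with coefficients in `L(ℂ, Y)`; then
`Z^a ⊗ f_a` acts as `u ↦ Z^a u ⊗ f_a`. -/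
def vecSeries (f : FormalSeries d Y) : FormalSeries d (ℂ →L[ℂ] Y) := fun a =>
  ContinuousLinearMap.toSpanSingleton ℂ (f a)

/-- The convergence set of a Hilbert space of formal power series: the points at which all its
elements converge. -/
def spaceConvSet (𝓗 : Type*) [NormedAddCommGroup 𝓗] [InnerProductSpace ℂ 𝓗]
    [RKHS ℂ 𝓗 (Word d) Y] : NCDomain d := fun _ =>
  {Z | ∀ f : 𝓗, ∃ S, HasSeriesSum Z (vecSeries (d := d) (f : Word d → Y)) S}

/-! Special domains, slices, and Taylor coefficients at `0`. -/

/-- The jointly nilpotent tuples: `Z^a = 0` for all sufficiently long words `a`. -/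
def Nilp (d : ℕ) : NCDomain d := fun _ => {Z | ∃ N : ℕ, ∀ a : Word d, N ≤ a.length → wordEval Z a = 0}

/-- Openness in the finite topology: openness along all complex lines. -/
def IsFinitelyOpen (Ω : NCDomain d) : Prop :=
  ∀ (n : ℕ), ∀ Z ∈ Ω n, ∀ D : MatTuple d n, ∃ ε > 0, ∀ t : ℂ, ‖t‖ < ε → Z + t • D ∈ Ω n

/-- `I`-local boundedness of a kernel along slices. -/
def IsLocallyBoundedAlongSlices {Ω : NCDomain d} (K : NCKernel Ω Y) : Prop :=
  ∀ (n : ℕ), ∀ Z ∈ Ω n, ∀ D : MatTuple d n, ∃ ε > 0, ∃ C : ℝ, ∀ t : ℂ, ‖t‖ < ε →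
    ∃ h : Z + t • D ∈ Ω n, ‖K n n ⟨Z + t • D, h⟩ ⟨Z + t • D, h⟩ 1‖ ≤ C

/-- The largest subset of `Ω` that is complete circular about `0`. -/
def circularCore (Ω : NCDomain d) : NCDomain d := fun n =>
  {Z | ∀ t : ℂ, ‖t‖ ≤ 1 → t • Z ∈ Ω n}

theorem circularCore_subset (Ω : NCDomain d) (n : ℕ) : circularCore Ω n ⊆ Ω n := fun Z hZ => by
  simpa using hZ 1 (by simp)

/-- For a word `a = i₁ ⋯ i_ℓ`, the upper bidiagonal tuple of size `ℓ + 1` with zero diagonal and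
with the standard basis vectors `e_{i₁}, …, e_{i_ℓ}` of `ℂ^d` on the superdiagonal. -/
def bidiagonal (a : Word d) : MatTuple d (a.length + 1) := fun k =>
  Matrix.of fun i j => if (j : ℕ) = i + 1 ∧ a[(i : ℕ)]? = some k then 1 else 0

open Classical in
/-- The Taylor coefficient `F_a = Δ_R^ℓ F(0, …, 0)(e_{i₁}, …, e_{i_ℓ})` at `0` of a nc function for
the word `a = i₁ ⋯ i_ℓ`. The higher order difference-differential operator `Δ_R^ℓ` is the upper
right corner of the value of `F` at the bidiagonal tuple, after a rescaling of that tuple by some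
`t ≠ 0` that brings it into the domain. -/
def taylorCoeff {Ω : NCDomain d} (F : NCMap Ω X Y) : FormalSeries d (X →L[ℂ] Y) := fun a =>
  if h : ∃ t : ℂ, t ≠ 0 ∧ t • bidiagonal a ∈ Ω (a.length + 1) then
    (h.choose ^ a.length)⁻¹ •
      blockEntry (F (a.length + 1) ⟨h.choose • bidiagonal a, h.choose_spec.2⟩) 0
        (Fin.last a.length)
  else 0

end Definitions

/-!
# Formal and noncommutative reproducing kernel Hilbert spaces

Everything rests on the observation that the reproducing kernel Hilbert space of a factored kernel,
formal or nc, sits isometrically in the coefficient space `X` of the factor. If `V` is the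
isometry `𝓚 → X` that sends the kernel elements to the vectors representing them, then the elements
of the nc space of `H(Z) (P ⊗ id) H(W)^*` are the functions `Z ↦ H(Z) (· ⊗ V g)`
(`IsNCRKHS.exists_isCarrier`), and the elements of the formal space of `𝐇(z) 𝐇(w)^*` are the series
`∑ 𝐇_a V f z^a` (`RKHS.exists_isometry`). Conversely, a subspace of `X` on which `H` lives is the nc
space of its kernel (`IsCarrier.isNCRKHS`). So, as soon as `H` is the sum of the series `𝐇` on a
domain that determines the coefficients, composing one isometry with the adjoint of the other is the
required unitary map, and it remains to study the convergence of the series.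

For a given formal series this is a matter of uniform boundedness
(`exists_hasSeriesSum_of_forall`). For a nc function `H` there are two steps. First, `H` is a
polynomial at the jointly nilpotent points of a fixed order, because the operator `e_a ↦ Z^a u`
intertwines the creation operators on the truncated Fock space with `Z`; the bidiagonal tuples
identify the coefficients as the Taylor coefficients
(`IsNCFunction.eq_partialSum_taylorCoeff`). Secondly, on a finitely open domain, local boundedness
implies analyticity along slices, because difference quotients are corners of values of `H` at block
triangular points (`IsNCFunction.differentiableAt_slice`). Then `t ↦ H(tZ)` is analytic near the
closed unit disc when `Z` is in the circular core. Its power series is identified by compressing the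
value of `H` at `Z ⊗ S`, where `S` is a perturbation of order `r ^ N` of the nilpotent `N × N` shift
that has the eigenvalue `r` (`IsNCFunction.isBigO_sub_partialSum`).

On the full domain the same composition of an isometry and an adjoint is a coisometry. Its kernel
consists of functions that vanish on the circular core, which are zero by the identity theorem along
slices when the levels of the domain are open and connected
(`IsNCFunction.eq_zero_of_circularCore`).

All analytic statements are made for matrix coefficients `φ (H(Z) ξ)`, which suffices for convergence
in the weak operator topology.
-/

noncomputable section NCKernels

variable {d : ℕ}
variable {X : Type*} [NormedAddCommGroup X] [InnerProductSpace ℂ X]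
variable {Y : Type*} [NormedAddCommGroup Y] [InnerProductSpace ℂ Y]

/-! ### Tensor products of matrices and operators -/

theorem tensorOp_comp_tensorOp {Y' : Type*} [NormedAddCommGroup Y'] [InnerProductSpace ℂ Y']
    {n m p : ℕ} (A : Matrix (Fin n) (Fin m) ℂ)
    (B : Matrix (Fin m) (Fin p) ℂ) (T : Y →L[ℂ] Y') (S : X →L[ℂ] Y) :
    tensorOp A T ∘L tensorOp B S = tensorOp (A * B) (T ∘L S) := by
  ext x i
  simp only [ContinuousLinearMap.comp_apply, tensorOp_apply, map_sum, map_smul, Finset.smul_sum,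
    Matrix.mul_apply, Finset.sum_smul, smul_smul]
  rw [Finset.sum_comm]

theorem tensorOp_zero_left {n m : ℕ} (T : X →L[ℂ] Y) :
    tensorOp (0 : Matrix (Fin n) (Fin m) ℂ) T = 0 := by
  ext x i
  simp [tensorOp_apply]

theorem tensorOp_smul_left {n m : ℕ} (c : ℂ) (A : Matrix (Fin n) (Fin m) ℂ) (T : X →L[ℂ] Y) :
    tensorOp (c • A) T = c • tensorOp A T := by
  ext x i
  simp [tensorOp_apply, mul_smul, Finset.smul_sum]

theorem scalarOp_one (n : ℕ) :
    scalarOp X (1 : Matrix (Fin n) (Fin n) ℂ) = ContinuousLinearMap.id ℂ _ := by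
  ext x i
  simp [scalarOp, tensorOp_apply, Matrix.one_apply]

theorem scalarOp_mul {n m p : ℕ} (A : Matrix (Fin n) (Fin m) ℂ) (B : Matrix (Fin m) (Fin p) ℂ) :
    scalarOp X (A * B) = scalarOp X A ∘L scalarOp X B := by
  rw [scalarOp, scalarOp, scalarOp, tensorOp_comp_tensorOp, ContinuousLinearMap.comp_id]

theorem scalarOp_zero {n m : ℕ} : scalarOp X (0 : Matrix (Fin n) (Fin m) ℂ) = 0 :=
  tensorOp_zero_left _

theorem scalarOp_comp_tensorOp {n m p : ℕ} (A : Matrix (Fin n) (Fin m) ℂ)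
    (B : Matrix (Fin m) (Fin p) ℂ) (T : X →L[ℂ] Y) :
    scalarOp Y A ∘L tensorOp B T = tensorOp (A * B) T := by
  rw [scalarOp, tensorOp_comp_tensorOp, ContinuousLinearMap.id_comp]

theorem tensorOp_comp_scalarOp {n m p : ℕ} (A : Matrix (Fin n) (Fin m) ℂ)
    (B : Matrix (Fin m) (Fin p) ℂ) (T : X →L[ℂ] Y) :
    tensorOp A T ∘L scalarOp X B = tensorOp (A * B) T := by
  rw [scalarOp, tensorOp_comp_tensorOp, ContinuousLinearMap.comp_id]

theorem scalarOp_conjTranspose [CompleteSpace X] {n m : ℕ} (A : Matrix (Fin n) (Fin m) ℂ) :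
    scalarOp X Aᴴ = (scalarOp X A).adjoint := by
  refine (ContinuousLinearMap.eq_adjoint_iff _ _).2 fun x y => ?_
  simp only [PiLp.inner_apply, scalarOp, tensorOp_apply, ContinuousLinearMap.id_apply,
    sum_inner, inner_sum, inner_smul_left, inner_smul_right, Matrix.conjTranspose_apply,
    RCLike.star_def, RCLike.conj_conj]
  rw [Finset.sum_comm]

/-- The operator `u ↦ u ⊗ x` from `ℂ^n` to `X^n`. -/
def colOp (n : ℕ) (x : X) : Amp ℂ n →L[ℂ] Amp X n :=
  tensorOp 1 (ContinuousLinearMap.toSpanSingleton ℂ x)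

theorem colOp_apply {n : ℕ} (x : X) (u : Amp ℂ n) (i : Fin n) : colOp n x u i = u i • x := by
  simp [colOp, tensorOp_apply, Matrix.one_apply]

theorem colOp_zero (n : ℕ) : colOp n (0 : X) = 0 := by
  ext u i
  simp [colOp_apply]

theorem colOp_add (n : ℕ) (x y : X) : colOp n (x + y) = colOp n x + colOp n y := by
  ext u i
  simp [colOp_apply]

theorem colOp_smul (n : ℕ) (c : ℂ) (x : X) : colOp n (c • x) = c • colOp n x := by
  ext u i
  simp [colOp_apply, smul_smul, mul_comm]

theorem scalarOp_comp_colOp {n m : ℕ} (A : Matrix (Fin m) (Fin n) ℂ) (x : X) :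
    scalarOp X A ∘L colOp n x = colOp m x ∘L scalarOp ℂ A := by
  rw [colOp, colOp, scalarOp_comp_tensorOp, tensorOp_comp_scalarOp, Matrix.mul_one,
    Matrix.one_mul]

/-- Every vector of `X^n` is the sum of the vectors `e_j ⊗ x_j`. -/
theorem sum_colOp_single {n : ℕ} (x : Amp X n) :
    ∑ j, colOp n (x j) (EuclideanSpace.single j (1 : ℂ)) = x := by
  ext i
  simp [colOp_apply]

theorem ext_colOp {n : ℕ} {E : Type*} [NormedAddCommGroup E] [NormedSpace ℂ E]
    {A B : Amp X n →L[ℂ] E} (h : ∀ x, A ∘L colOp n x = B ∘L colOp n x) : A = B := by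
  ext x
  rw [← sum_colOp_single x, map_sum, map_sum]
  exact Finset.sum_congr rfl fun j _ => DFunLike.congr_fun (h (x j)) _

/-- The row operator `ξ ↦ ∑ v_j ξ_j` is adjoint to the column operators. -/
theorem inner_colOp {n : ℕ} (ξ : Amp X n) (v : Fin n → ℂ) (x : X) :
    inner ℂ ξ (colOp n x (WithLp.toLp 2 (star v))) = inner ℂ (∑ j, v j • ξ j) x := by
  simp [PiLp.inner_apply, colOp_apply, inner_smul_right, mul_comm]

theorem colOp_sum_smul {n m : ℕ} (u : Amp ℂ n) (v : Fin m → ℂ) (ξ : Amp X m) :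
    colOp n (∑ j, v j • ξ j) u = scalarOp X (Matrix.vecMulVec u v) ξ := by
  ext i
  simp [colOp_apply, scalarOp, tensorOp_apply, Matrix.vecMulVec_apply, Finset.smul_sum, mul_smul]

theorem blockEntry_apply {n m : ℕ} (S : Amp X m →L[ℂ] Amp Y n) (i : Fin n) (j : Fin m) (x : X) :
    blockEntry S i j x = S (colOp m x (EuclideanSpace.single j 1)) i := by
  have : colOp m x (EuclideanSpace.single j 1) = WithLp.toLp 2 (Pi.single j x) := by
    ext k
    rcases eq_or_ne k j with rfl | h <;> simp [colOp_apply, *]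
  rw [this]
  rfl

theorem blockEntry_sum {n m : ℕ} {ι : Type*} (s : Finset ι) (S : ι → Amp X m →L[ℂ] Amp Y n)
    (i : Fin n) (j : Fin m) :
    blockEntry (∑ a ∈ s, S a) i j = ∑ a ∈ s, blockEntry (S a) i j := by
  ext x
  simp [blockEntry_apply]

theorem blockEntry_comp_colOp {n m : ℕ} (S : Amp X m →L[ℂ] Amp Y n) (i : Fin n) (j : Fin m)
    (x : X) : blockEntry (S ∘L colOp m x) i j 1 = blockEntry S i j x := by
  have h : colOp m (1 : ℂ) (EuclideanSpace.single j 1) = EuclideanSpace.single j 1 := by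
    ext k
    simp [colOp_apply]
  rw [blockEntry_apply, blockEntry_apply, ContinuousLinearMap.comp_apply, h]

/-! ### Words and the convergence of series -/

theorem wordEval_nil {n : ℕ} (Z : MatTuple d n) : wordEval Z [] = 1 := rfl

theorem wordEval_cons {n : ℕ} (Z : MatTuple d n) (k : Fin d) (a : Word d) :
    wordEval Z (k :: a) = Z k * wordEval Z a := by
  simp [wordEval]

theorem wordEval_smul {n : ℕ} (t : ℂ) (Z : MatTuple d n) (a : Word d) :
    wordEval (t • Z) a = t ^ a.length • wordEval Z a := by
  induction a with
  | nil => simp [wordEval_nil]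
  | cons k a ih => simp [wordEval_cons, ih, pow_succ', smul_smul, mul_comm]

theorem mul_wordEval {n m : ℕ} {Z : MatTuple d n} {Z' : MatTuple d m}
    {α : Matrix (Fin m) (Fin n) ℂ} (h : ∀ k, α * Z k = Z' k * α) (a : Word d) :
    α * wordEval Z a = wordEval Z' a * α := by
  induction a with
  | nil => simp [wordEval_nil]
  | cons k a ih =>
    rw [wordEval_cons, wordEval_cons, ← Matrix.mul_assoc, h, Matrix.mul_assoc, ih, Matrix.mul_assoc]

/-- The homogeneous part `∑_{|a| = ℓ} Z^a ⊗ T_a` of degree `ℓ`. -/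
def homPart {n : ℕ} (Z : MatTuple d n) (T : FormalSeries d (X →L[ℂ] Y)) (ℓ : ℕ) :
    Amp X n →L[ℂ] Amp Y n :=
  ∑ a : Fin ℓ → Fin d, tensorOp (wordEval Z (List.ofFn a)) (T (List.ofFn a))

theorem partialSum_eq {n : ℕ} (Z : MatTuple d n) (T : FormalSeries d (X →L[ℂ] Y)) (N : ℕ) :
    partialSum Z T N = ∑ ℓ ∈ Finset.range N, homPart Z T ℓ := rfl

theorem homPart_smul {n : ℕ} (t : ℂ) (Z : MatTuple d n) (T : FormalSeries d (X →L[ℂ] Y)) (ℓ : ℕ) :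
    homPart (t • Z) T ℓ = t ^ ℓ • homPart Z T ℓ := by
  simp [homPart, Finset.smul_sum, wordEval_smul, tensorOp_smul_left]

theorem scalarOp_comp_partialSum {n m : ℕ} {Z : MatTuple d n} {Z' : MatTuple d m}
    {α : Matrix (Fin m) (Fin n) ℂ} (h : ∀ k, α * Z k = Z' k * α)
    (T : FormalSeries d (X →L[ℂ] Y)) (N : ℕ) :
    scalarOp Y α ∘L partialSum Z T N = partialSum Z' T N ∘L scalarOp X α := by
  simp only [partialSum, ContinuousLinearMap.comp_finsetSum,
    ContinuousLinearMap.finsetSum_comp, scalarOp_comp_tensorOp, tensorOp_comp_scalarOp,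
    mul_wordEval h]

theorem tensorOp_comp_colOp {n : ℕ} (A : Matrix (Fin n) (Fin n) ℂ) (T : X →L[ℂ] Y) (x : X) :
    tensorOp A T ∘L colOp n x = tensorOp A (ContinuousLinearMap.toSpanSingleton ℂ (T x)) := by
  rw [colOp, tensorOp_comp_tensorOp, mul_one]
  congr 1
  ext
  simp

theorem partialSum_comp_colOp {n : ℕ} (Z : MatTuple d n) (T : FormalSeries d (X →L[ℂ] Y)) (N : ℕ)
    (x : X) : partialSum Z T N ∘L colOp n x = partialSum Z (vecSeries fun a => T a x) N := by
  simp only [partialSum, ContinuousLinearMap.finsetSum_comp, tensorOp_comp_colOp, vecSeries]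

theorem hasSeriesSum_iff {n : ℕ} {Z : MatTuple d n} {T : FormalSeries d (X →L[ℂ] Y)}
    {S : Amp X n →L[ℂ] Amp Y n} :
    HasSeriesSum Z T S ↔ ∀ (x : Amp X n) (φ : StrongDual ℂ (Amp Y n)),
      Tendsto (fun N => φ (partialSum Z T N x)) atTop (𝓝 (φ (S x))) :=
  ContinuousLinearMapWOT.tendsto_iff_forall_dual_apply_tendsto

theorem HasSeriesSum.unique {n : ℕ} {Z : MatTuple d n} {T : FormalSeries d (X →L[ℂ] Y)}
    {S S' : Amp X n →L[ℂ] Amp Y n} (h : HasSeriesSum Z T S) (h' : HasSeriesSum Z T S') :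
    S = S' :=
  ContinuousLinearMapWOT.ofCLM_injective (tendsto_nhds_unique h h')

theorem hasSeriesSum_seriesSum {n : ℕ} {Z : MatTuple d n} {T : FormalSeries d (X →L[ℂ] Y)}
    (h : ∃ S, HasSeriesSum Z T S) : HasSeriesSum Z T (seriesSum Z T) := by
  rw [seriesSum, dif_pos h]
  exact h.choose_spec

theorem HasSeriesSum.seriesSum_eq {n : ℕ} {Z : MatTuple d n} {T : FormalSeries d (X →L[ℂ] Y)}
    {S : Amp X n →L[ℂ] Amp Y n} (h : HasSeriesSum Z T S) : seriesSum Z T = S :=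
  (hasSeriesSum_seriesSum ⟨S, h⟩).unique h

theorem hasSeriesSum_of_tendsto {n : ℕ} {Z : MatTuple d n} {T : FormalSeries d (X →L[ℂ] Y)}
    {S : Amp X n →L[ℂ] Amp Y n} (h : Tendsto (partialSum Z T) atTop (𝓝 S)) :
    HasSeriesSum Z T S :=
  (ContinuousLinearMapWOT.continuous_ofCLM.tendsto S).comp h

theorem hasSeriesSum_of_eventually_eq {n : ℕ} {Z : MatTuple d n} {T : FormalSeries d (X →L[ℂ] Y)}
    {S : Amp X n →L[ℂ] Amp Y n} (N : ℕ) (h : ∀ M ≥ N, partialSum Z T M = S) :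
    HasSeriesSum Z T S :=
  hasSeriesSum_of_tendsto <| tendsto_const_nhds.congr' <| by
    filter_upwards [eventually_ge_atTop N] with M hM using (h M hM).symm

theorem HasSeriesSum.comp_colOp {n : ℕ} {Z : MatTuple d n} {T : FormalSeries d (X →L[ℂ] Y)}
    {S : Amp X n →L[ℂ] Amp Y n} (h : HasSeriesSum Z T S) (x : X) :
    HasSeriesSum Z (vecSeries fun a => T a x) (S ∘L colOp n x) := by
  rw [hasSeriesSum_iff] at h ⊢
  intro u φ
  simp only [← partialSum_comp_colOp]
  exact h (colOp n x u) φ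

theorem HasSeriesSum.intertwine {n m : ℕ} {Z : MatTuple d n} {Z' : MatTuple d m}
    {α : Matrix (Fin m) (Fin n) ℂ} {T : FormalSeries d (X →L[ℂ] Y)}
    {S : Amp X n →L[ℂ] Amp Y n} {S' : Amp X m →L[ℂ] Amp Y m} (hS : HasSeriesSum Z T S)
    (hS' : HasSeriesSum Z' T S') (h : ∀ k, α * Z k = Z' k * α) :
    scalarOp Y α ∘L S = S' ∘L scalarOp X α := by
  rw [hasSeriesSum_iff] at hS hS'
  ext1 x
  refine (SeparatingDual.eq_iff_forall_dual_eq (R := ℂ)).2 fun φ => ?_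
  refine tendsto_nhds_unique (hS x (φ ∘L scalarOp Y α)) ?_
  refine (hS' (scalarOp X α x) φ).congr fun N => ?_
  exact congrArg φ (DFunLike.congr_fun (scalarOp_comp_partialSum h T N).symm x)

/-- The isometric inclusion of `ℂ^n` into `ℂ^{n + m}` as the first summand. -/
def inlMat (n m : ℕ) : Matrix (Fin (n + m)) (Fin n) ℂ :=
  Matrix.of fun i j => if i = Fin.castAdd m j then 1 else 0

/-- The isometric inclusion of `ℂ^m` into `ℂ^{n + m}` as the second summand. -/
def inrMat (n m : ℕ) : Matrix (Fin (n + m)) (Fin m) ℂ :=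
  Matrix.of fun i j => if i = Fin.natAdd n j then 1 else 0

theorem inlMat_mul_inlMat (n m : ℕ) : (inlMat n m)ᵀ * inlMat n m = 1 := by
  ext i j
  simp [inlMat, Matrix.mul_apply, Matrix.one_apply, eq_comm]

theorem inrMat_mul_inrMat (n m : ℕ) : (inrMat n m)ᵀ * inrMat n m = 1 := by
  ext i j
  simp [inrMat, Matrix.mul_apply, Matrix.one_apply, eq_comm]

theorem castAdd_ne_natAdd {n m : ℕ} (i : Fin n) (j : Fin m) : Fin.castAdd m i ≠ Fin.natAdd n j := by
  simp only [ne_eq, Fin.ext_iff, Fin.val_castAdd, Fin.val_natAdd]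
  lia

theorem inlMat_mul_inrMat (n m : ℕ) : (inlMat n m)ᵀ * inrMat n m = 0 := by
  ext i j
  simp [inlMat, inrMat, Matrix.mul_apply, (castAdd_ne_natAdd _ _).symm]

theorem inrMat_mul_inlMat (n m : ℕ) : (inrMat n m)ᵀ * inlMat n m = 0 := by
  rw [← Matrix.transpose_transpose (inlMat n m), ← Matrix.transpose_mul, inlMat_mul_inrMat,
    Matrix.transpose_zero]

theorem inlMat_add_inrMat (n m : ℕ) :
    inlMat n m * (inlMat n m)ᵀ + inrMat n m * (inrMat n m)ᵀ = 1 := by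
  ext i j
  refine Fin.addCases (fun i => ?_) (fun i => ?_) i <;>
  refine Fin.addCases (fun j => ?_) (fun j => ?_) j <;>
  simp [inlMat, inrMat, Matrix.mul_apply, Matrix.one_apply, castAdd_ne_natAdd,
    (castAdd_ne_natAdd _ _).symm]

theorem directSum_eq {n m : ℕ} (Z : MatTuple d n) (W : MatTuple d m) (k : Fin d) :
    directSum Z W k = inlMat n m * Z k * (inlMat n m)ᵀ + inrMat n m * W k * (inrMat n m)ᵀ := by
  ext i j
  refine Fin.addCases (fun i => ?_) (fun i => ?_) i <;>
  refine Fin.addCases (fun j => ?_) (fun j => ?_) j <;>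
  simp [directSum, inlMat, inrMat, Matrix.mul_apply, castAdd_ne_natAdd,
    (castAdd_ne_natAdd _ _).symm]

/-! ### Isometries between Hilbert spaces with prescribed kernel elements -/

section Gram

variable {𝓗 : Type*} [NormedAddCommGroup 𝓗] [InnerProductSpace ℂ 𝓗] [CompleteSpace 𝓗]
variable {𝓗' : Type*} [NormedAddCommGroup 𝓗'] [InnerProductSpace ℂ 𝓗'] [CompleteSpace 𝓗']

/-- A total family is carried by an isometry to any family with the same Gram matrix. -/
theorem exists_linearIsometry_of_inner_eq {ι : Type*} (k : ι → 𝓗) (k' : ι → 𝓗')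
    (h : ∀ i j, inner ℂ (k i) (k j) = inner ℂ (k' i) (k' j))
    (hk : ∀ g : 𝓗, (∀ i, inner ℂ (k i) g = 0) → g = 0) :
    ∃ V : 𝓗 →ₗᵢ[ℂ] 𝓗', ∀ i, V (k i) = k' i := by
  let A : (ι →₀ ℂ) →ₗ[ℂ] 𝓗 := Finsupp.linearCombination ℂ k
  let B : (ι →₀ ℂ) →ₗ[ℂ] 𝓗' := Finsupp.linearCombination ℂ k'
  have hnorm : ∀ c, ‖B c‖ = ‖A c‖ := fun c => by
    have : inner ℂ (A c) (A c) = inner ℂ (B c) (B c) := by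
      simp only [A, B, Finsupp.linearCombination_apply, Finsupp.sum_inner, Finsupp.inner_sum,
        inner_smul_left, inner_smul_right, h]
    rw [@norm_eq_sqrt_re_inner ℂ, @norm_eq_sqrt_re_inner ℂ _ _ _ _ (A c), this]
  have hdense : DenseRange A := by
    have h1 : (LinearMap.range A).topologicalClosure = ⊤ := by
      rw [Submodule.topologicalClosure_eq_top_iff, Submodule.eq_bot_iff]
      intro g hg
      refine hk g fun i => ?_
      rw [Submodule.mem_orthogonal] at hg
      exact hg (k i) ⟨Finsupp.single i 1, by simp [A]⟩
    exact Submodule.dense_iff_topologicalClosure_eq_top.2 h1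
  have hC : ∃ C, ∀ c, ‖B c‖ ≤ C * ‖A c‖ := ⟨1, fun c => by rw [one_mul, hnorm]⟩
  let V := B.extendOfNorm A
  have hV : ∀ c, V (A c) = B c := fun c => LinearMap.extendOfNorm_eq hdense hC c
  refine ⟨⟨V.toLinearMap, fun g => ?_⟩, fun i => ?_⟩
  · change ‖V g‖ = ‖g‖
    refine hdense.induction_on (p := fun g => ‖V g‖ = ‖g‖) g
      (isClosed_eq (by fun_prop) (by fun_prop)) fun c => ?_
    rw [hV, hnorm]
  · have := hV (Finsupp.single i 1)
    simpa [A, B] using this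

variable (V : 𝓗 →ₗᵢ[ℂ] 𝓗')

/-- The adjoint of an isometry. -/
abbrev LinearIsometry.adj (V : 𝓗 →ₗᵢ[ℂ] 𝓗') : 𝓗' →L[ℂ] 𝓗 := V.toContinuousLinearMap.adjoint

theorem LinearIsometry.adj_apply_apply (g : 𝓗) : V.adj (V g) = g :=
  ext_inner_left ℂ fun f => by
    rw [ContinuousLinearMap.adjoint_inner_right]
    exact V.inner_map_map f g

theorem LinearIsometry.inner_adj (g : 𝓗) (x : 𝓗') : inner ℂ g (V.adj x) = inner ℂ (V g) x :=
  ContinuousLinearMap.adjoint_inner_right _ _ _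

theorem LinearIsometry.inner_apply_adj (x y : 𝓗') :
    inner ℂ x (V (V.adj y)) = inner ℂ (V (V.adj x)) y := by
  rw [← V.inner_adj, ← inner_conj_symm, ← V.inner_adj, inner_conj_symm]

/-- A continuous operator with two-sided inverse its adjoint is unitary. -/
theorem exists_linearIsometryEquiv (T : 𝓗 →L[ℂ] 𝓗') (h : ∀ g, T.adjoint (T g) = g)
    (h' : ∀ f, T (T.adjoint f) = f) : ∃ U : 𝓗 ≃ₗᵢ[ℂ] 𝓗', ∀ g, U g = T g := by
  refine ⟨⟨⟨T.toLinearMap, T.adjoint, h, h'⟩, fun g => ?_⟩, fun g => rfl⟩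
  change ‖T g‖ = ‖g‖
  rw [@norm_eq_sqrt_re_inner ℂ, @norm_eq_sqrt_re_inner ℂ _ _ _ _ g,
    ← ContinuousLinearMap.adjoint_inner_right, h]

end Gram

/-! ### Reproducing kernel Hilbert spaces of factored kernels -/

/-- The vectors of `X` that represent the kernel elements `K_{W,v,y}` of the kernel
`H(Z) (P ⊗ id) H(W)^*`. -/
def kerVec [CompleteSpace X] [CompleteSpace Y] {Ω : NCDomain d} (H : NCMap Ω X Y) {m : ℕ} (W : Ω m)
    (v : Fin m → ℂ) (y : Amp Y m) : X :=
  ∑ j, v j • (H m W).adjoint y j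

theorem kolmogorovKernel_vecMulVec [CompleteSpace X] [CompleteSpace Y] {Ω : NCDomain d}
    (H : NCMap Ω X Y) {n m : ℕ} (Z : Ω n) (W : Ω m) (u : Amp ℂ n) (v : Fin m → ℂ) (y : Amp Y m) :
    kolmogorovKernel H n m Z W (Matrix.vecMulVec u v) y =
      (H n Z ∘L colOp n (kerVec H W v y)) u := by
  rw [ContinuousLinearMap.comp_apply, kerVec, colOp_sum_smul]
  rfl

theorem inner_kerVec [CompleteSpace X] [CompleteSpace Y] {Ω : NCDomain d}
    (H : NCMap Ω X Y) {m : ℕ} (W : Ω m) (v : Fin m → ℂ) (y : Amp Y m) (x : X) :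
    inner ℂ (kerVec H W v y) x = inner ℂ y ((H m W ∘L colOp m x) (WithLp.toLp 2 (star v))) := by
  rw [kerVec, ← inner_colOp, ContinuousLinearMap.adjoint_inner_left]
  rfl

section Model

variable [CompleteSpace X] [CompleteSpace Y] {Ω : NCDomain d} {H : NCMap Ω X Y}
variable {𝓗 : Type*} [NormedAddCommGroup 𝓗] [InnerProductSpace ℂ 𝓗] [CompleteSpace 𝓗]

/-- `V` realizes a Hilbert space `𝓗` as a subspace of `X` on which the values of `H` live: composing
the values of `H` with the projection onto the range of `V` does not change them. -/
def IsCarrier (H : NCMap Ω X Y) (V : 𝓗 →ₗᵢ[ℂ] X) : Prop :=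
  ∀ (x : X) (n : ℕ) (Z : Ω n), H n Z ∘L colOp n (V (V.adj x)) = H n Z ∘L colOp n x

/-- The reproducing kernel Hilbert space of `H(Z) (P ⊗ id) H(W)^*` sits isometrically in `X`, and its
elements are the functions `Z ↦ H(Z) (· ⊗ x)`. -/
theorem IsNCRKHS.exists_isCarrier {ev : 𝓗 → NCMap Ω ℂ Y}
    (h : IsNCRKHS (kolmogorovKernel H) 𝓗 ev) :
    ∃ V : 𝓗 →ₗᵢ[ℂ] X, IsCarrier H V ∧
      ∀ (g : 𝓗) (n : ℕ) (Z : Ω n), ev g n Z = H n Z ∘L colOp n (V g) := by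
  choose k hk hr using h.reproducing
  let ι := Σ m : ℕ, Ω m × (Fin m → ℂ) × Amp Y m
  have hev0 : ev 0 = 0 := by
    have := h.ev_add 0 0
    rwa [add_zero, left_eq_add] at this
  have hkv : ∀ (m : ℕ) (W : Ω m) (v : Fin m → ℂ) (y : Amp Y m) (n : ℕ) (Z : Ω n),
      ev (k m W v y) n Z = H n Z ∘L colOp n (kerVec H W v y) := fun m W v y n Z => by
    ext1 u
    rw [hk, kolmogorovKernel_vecMulVec]
  obtain ⟨V, hV⟩ := exists_linearIsometry_of_inner_eq
    (fun i : ι => k i.1 i.2.1 i.2.2.1 i.2.2.2) (fun i : ι => kerVec H i.2.1 i.2.2.1 i.2.2.2)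
    (fun i j => by simp only [hr, hkv, inner_kerVec])
    (fun g hg => h.ev_injective <| by
      rw [hev0]
      funext n Z
      ext1 u
      refine ext_inner_left ℂ fun y => ?_
      have := hr n Z (star u.ofLp) y g
      rw [star_star] at this
      rw [← this]
      simpa using hg ⟨n, Z, star u.ofLp, y⟩)
  have hVk : ∀ (m : ℕ) (W : Ω m) (v : Fin m → ℂ) (y : Amp Y m),
      V (k m W v y) = kerVec H W v y := fun m W v y => hV ⟨m, W, v, y⟩
  refine ⟨V, fun x n Z => ?_, fun g n Z => ?_⟩
  · ext1 u
    refine ext_inner_left ℂ fun y => ?_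
    have h1 := inner_kerVec H Z (star u.ofLp) y
    simp only [star_star] at h1
    change inner ℂ y ((H n Z ∘L colOp n _) (WithLp.toLp 2 u.ofLp)) =
      inner ℂ y ((H n Z ∘L colOp n _) (WithLp.toLp 2 u.ofLp))
    rw [← h1, ← h1, V.inner_apply_adj, ← hVk, V.adj_apply_apply]
  · ext1 u
    refine ext_inner_left ℂ fun y => ?_
    have h1 := inner_kerVec H Z (star u.ofLp) y (V g)
    have h2 := hr n Z (star u.ofLp) y g
    rw [star_star] at h1 h2
    change inner ℂ y (ev g n Z (WithLp.toLp 2 u.ofLp)) =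
      inner ℂ y ((H n Z ∘L colOp n (V g)) (WithLp.toLp 2 u.ofLp))
    rw [← h1, ← h2, ← hVk, V.inner_map_map]

/-- A carrier of `H` is the reproducing kernel Hilbert space of `H(Z) (P ⊗ id) H(W)^*`. -/
theorem IsCarrier.isNCRKHS (hH : IsNCFunction H) {V : 𝓗 →ₗᵢ[ℂ] X} (hV : IsCarrier H V)
    {ev : 𝓗 → NCMap Ω ℂ Y}
    (hev : ∀ (g : 𝓗) (n : ℕ) (Z : Ω n), ev g n Z = H n Z ∘L colOp n (V g))
    (hinj : Function.Injective ev) : IsNCRKHS (kolmogorovKernel H) 𝓗 ev where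
  ev_add f g := by
    funext n Z
    simp only [Pi.add_apply, hev, map_add, colOp_add, ContinuousLinearMap.comp_add]
  ev_smul c f := by
    funext n Z
    simp only [Pi.smul_apply, hev, map_smul, colOp_smul, ContinuousLinearMap.comp_smul]
  ev_injective := hinj
  isNCFunction f n m Z Z' α hα := by
    rw [hev, hev, ← ContinuousLinearMap.comp_assoc, hH n m Z Z' α hα,
      ContinuousLinearMap.comp_assoc, scalarOp_comp_colOp, ContinuousLinearMap.comp_assoc]
  reproducing m W v y := by
    refine ⟨V.adj (kerVec H W v y), fun n Z u => ?_, fun f => ?_⟩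
    · rw [hev, hV, kolmogorovKernel_vecMulVec]
    · rw [hev, ← inner_kerVec, ← inner_conj_symm, V.inner_adj, inner_conj_symm]

omit [CompleteSpace Y] in
/-- Two carriers of `H` whose elements are determined by their functions are unitarily equivalent,
by a map that does not change the functions. -/
theorem IsCarrier.exists_linearIsometryEquiv
    {𝓗' : Type*} [NormedAddCommGroup 𝓗'] [InnerProductSpace ℂ 𝓗'] [CompleteSpace 𝓗']
    {V : 𝓗 →ₗᵢ[ℂ] X} (hV : IsCarrier H V) {V' : 𝓗' →ₗᵢ[ℂ] X} (hV' : IsCarrier H V')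
    (hinj : ∀ f g : 𝓗, (∀ n Z, H n Z ∘L colOp n (V f) = H n Z ∘L colOp n (V g)) → f = g)
    (hinj' : ∀ f g : 𝓗', (∀ n Z, H n Z ∘L colOp n (V' f) = H n Z ∘L colOp n (V' g)) → f = g) :
    ∃ U : 𝓗 ≃ₗᵢ[ℂ] 𝓗', ∀ g, U g = V'.adj (V g) := by
  have hadj : (V'.adj ∘L V.toContinuousLinearMap).adjoint = V.adj ∘L V'.toContinuousLinearMap := by
    rw [ContinuousLinearMap.adjoint_comp, ContinuousLinearMap.adjoint_adjoint]
  refine _root_.exists_linearIsometryEquiv (V'.adj ∘L V.toContinuousLinearMap)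
    (fun g => ?_) (fun f => ?_) <;> rw [hadj]
  · exact hinj _ _ fun n Z => (hV _ n Z).trans (hV' _ n Z)
  · exact hinj' _ _ fun n Z => (hV' _ n Z).trans (hV _ n Z)

end Model

/-! ### Kernels and their nc functions -/

open scoped MatrixOrder Matrix.Norms.L2Operator in
/-- The kernel `H(Z) (P ⊗ id) H(W)^*` of a nc function is a cp nc kernel. -/
theorem IsNCFunction.isCPNCKernel [CompleteSpace X] [CompleteSpace Y] {Ω : NCDomain d}
    {H : NCMap Ω X Y} (hH : IsNCFunction H) : IsCPNCKernel (kolmogorovKernel H) := by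
  refine ⟨fun n n' m m' Z Z' W W' α β P hα hβ => ?_, fun n Z P hP => ?_⟩
  · have h1 := hH n n' Z Z' α hα
    have h2 := congrArg ContinuousLinearMap.adjoint (hH m m' W W' β hβ)
    rw [ContinuousLinearMap.adjoint_comp, ContinuousLinearMap.adjoint_comp,
      ← scalarOp_conjTranspose, ← scalarOp_conjTranspose] at h2
    change scalarOp Y α ∘L (H n Z ∘L scalarOp X P ∘L (H m W).adjoint) ∘L scalarOp Y βᴴ =
      H n' Z' ∘L scalarOp X (α * P * βᴴ) ∘L (H m' W').adjoint
    simp only [scalarOp_mul, ContinuousLinearMap.comp_assoc, ← h2]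
    simp only [← ContinuousLinearMap.comp_assoc, ← h1]
  · obtain ⟨B, rfl⟩ := CStarAlgebra.nonneg_iff_eq_star_mul_self.1 hP.nonneg
    rw [Matrix.star_eq_conjTranspose]
    change (H n Z ∘L scalarOp X (Bᴴ * B) ∘L (H n Z).adjoint).IsPositive
    rw [scalarOp_mul, scalarOp_conjTranspose]
    have := ContinuousLinearMap.isPositive_self_comp_adjoint (H n Z ∘L (scalarOp X B).adjoint)
    rw [ContinuousLinearMap.adjoint_comp, ContinuousLinearMap.adjoint_adjoint] at this
    simpa only [ContinuousLinearMap.comp_assoc] using this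

theorem norm_sq_eq_norm_kolmogorovKernel [CompleteSpace X] [CompleteSpace Y] {Ω : NCDomain d}
    (H : NCMap Ω X Y) {n : ℕ} (Z : Ω n) :
    ‖H n Z‖ ^ 2 = ‖kolmogorovKernel H n n Z Z 1‖ := by
  change _ = ‖H n Z ∘L scalarOp X 1 ∘L (H n Z).adjoint‖
  rw [scalarOp_one, ContinuousLinearMap.id_comp]
  have := ContinuousLinearMap.norm_adjoint_comp_self (H n Z).adjoint
  rw [ContinuousLinearMap.adjoint_adjoint, LinearIsometryEquiv.norm_map] at this
  rw [this, sq]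

theorem isPositiveFormalKernel_formalKolmogorov [CompleteSpace X] [CompleteSpace Y]
    (Hf : FormalSeries d (X →L[ℂ] Y)) : IsPositiveFormalKernel (formalKolmogorov Hf) := by
  intro y
  have : (y.sum fun a ya => y.sum fun b yb => inner ℂ ya (formalKolmogorov Hf a b yb)) =
      inner ℂ (y.sum fun a ya => (Hf a).adjoint ya) (y.sum fun a ya => (Hf a).adjoint ya) := by
    simp only [Finsupp.sum, sum_inner, inner_sum, formalKolmogorov,
      ContinuousLinearMap.comp_apply, ContinuousLinearMap.adjoint_inner_left]
    exact Finset.sum_comm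
  rw [this, inner_self_eq_norm_sq_to_K]
  positivity

/-- A formal reproducing kernel Hilbert space with the kernel `Hf(z) Hf(w)^*` sits isometrically in
`X`, and its elements are the series `∑ H_a x z^a`. -/
theorem RKHS.exists_isometry [CompleteSpace X] [CompleteSpace Y] {ι : Type*}
    (𝓕 : Type*) [NormedAddCommGroup 𝓕] [InnerProductSpace ℂ 𝓕] [CompleteSpace 𝓕]
    [RKHS ℂ 𝓕 ι Y] (Hf : ι → X →L[ℂ] Y)
    (h : ∀ a b, RKHS.kernel 𝓕 a b = Hf a ∘L (Hf b).adjoint) :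
    ∃ V : 𝓕 →ₗᵢ[ℂ] X, (∀ (f : 𝓕) (a : ι), f a = Hf a (V f)) ∧
      ∀ (x : X) (a : ι), (V.adj x) a = Hf a x := by
  obtain ⟨V, hV⟩ := exists_linearIsometry_of_inner_eq
    (fun i : ι × Y => RKHS.kerFun 𝓕 i.1 i.2) (fun i : ι × Y => (Hf i.1).adjoint i.2)
    (fun i j => by
      rw [RKHS.kerFun_inner, RKHS.kerFun_apply, h, ContinuousLinearMap.adjoint_inner_left]
      rfl)
    (fun g hg => RKHS.ext fun a => ext_inner_left ℂ fun y => by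
      rw [← RKHS.kerFun_inner, hg (a, y)]
      simp)
  refine ⟨V, fun f a => ext_inner_left ℂ fun y => ?_, fun x a => ext_inner_left ℂ fun y => ?_⟩
  · rw [← RKHS.kerFun_inner, ← V.inner_map_map, hV (a, y), ContinuousLinearMap.adjoint_inner_left]
  · rw [← RKHS.kerFun_inner, V.inner_adj, hV (a, y), ContinuousLinearMap.adjoint_inner_left]

/-! ### Nilpotent points and Taylor coefficients -/

/-- The words of length less than `N`; they index the basis of the truncated Fock space. -/
abbrev FockIndex (d N : ℕ) : Type := Σ ℓ : Fin N, (Fin ℓ → Fin d)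

/-- The word of an index of the truncated Fock space. -/
abbrev FockIndex.word {N : ℕ} (p : FockIndex d N) : Word d := List.ofFn p.2

theorem FockIndex.length_word {N : ℕ} (p : FockIndex d N) : p.word.length = p.1 :=
  List.length_ofFn

theorem FockIndex.word_injective {N : ℕ} :
    Function.Injective (FockIndex.word : FockIndex d N → Word d) := by
  rintro ⟨⟨ℓ, hℓ⟩, f⟩ ⟨⟨m, hm⟩, g⟩ h
  have := List.ofFn_inj'.1 h
  cases this
  rfl

theorem FockIndex.exists_word_eq {N : ℕ} {a : Word d} (ha : a.length < N) :
    ∃ p : FockIndex d N, p.word = a :=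
  ⟨⟨⟨a.length, ha⟩, a.get⟩, List.ofFn_get a⟩

theorem sum_words_eq_sum_fockIndex {E : Type*} [AddCommMonoid E] (f : Word d → E) (N : ℕ) :
    ∑ ℓ ∈ Finset.range N, ∑ a : Fin ℓ → Fin d, f (List.ofFn a) =
      ∑ p : FockIndex d N, f p.word := by
  rw [Fintype.sum_sigma, Finset.sum_range]

/-- The tuple of creation operators `e_a ↦ e_{ka}` on the Fock space of words of length less than
`N`, where words of length `N` are replaced by `0`. -/
def creation (d N : ℕ) : MatTuple d (Fintype.card (FockIndex d N)) := fun k =>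
  Matrix.of fun i j =>
    if ((Fintype.equivFin _).symm i).word = k :: ((Fintype.equivFin _).symm j).word then 1 else 0

theorem wordEval_creation_apply_eq_zero {N : ℕ} (a : Word d)
    (i j : Fin (Fintype.card (FockIndex d N)))
    (h : ((Fintype.equivFin _).symm i).word.length <
      a.length + ((Fintype.equivFin _).symm j).word.length) :
    wordEval (creation d N) a i j = 0 := by
  induction a generalizing i with
  | nil =>
    rw [wordEval_nil, Matrix.one_apply_ne]
    rintro rfl
    simp at h
  | cons k a ih =>
    rw [wordEval_cons, Matrix.mul_apply]
    refine Finset.sum_eq_zero fun r _ => ?_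
    by_cases hr : ((Fintype.equivFin _).symm i).word = k :: ((Fintype.equivFin _).symm r).word
    · rw [ih r, mul_zero]
      rw [hr] at h
      simp only [List.length_cons] at h
      lia
    · simp [creation, hr]

theorem wordEval_creation_eq_zero {N : ℕ} {a : Word d} (ha : N ≤ a.length) :
    wordEval (creation d N) a = 0 := by
  ext i j
  refine wordEval_creation_apply_eq_zero a i j ?_
  have := ((Fintype.equivFin (FockIndex d N)).symm i).1.2
  rw [FockIndex.length_word]
  lia

/-- The matrix of `e_a ↦ t^{-|a|} Z^a u`. It intertwines the scaled creation operators with `Z`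
when `Z` is jointly nilpotent of order `N`. -/
def fockMap (N : ℕ) {n : ℕ} (Z : MatTuple d n) (t : ℂ) (u : Fin n → ℂ) :
    Matrix (Fin n) (Fin (Fintype.card (FockIndex d N))) ℂ :=
  Matrix.of fun i j => t⁻¹ ^ ((Fintype.equivFin _).symm j).word.length *
    (wordEval Z ((Fintype.equivFin _).symm j).word *ᵥ u) i

theorem fockMap_mul_creation {N n : ℕ} {Z : MatTuple d n}
    (hZ : ∀ a : Word d, N ≤ a.length → wordEval Z a = 0) {t : ℂ} (ht : t ≠ 0) (u : Fin n → ℂ)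
    (k : Fin d) : fockMap N Z t u * (t • creation d N) k = Z k * fockMap N Z t u := by
  ext i j
  set q := (Fintype.equivFin (FockIndex d N)).symm j with hq
  have hR : (Z k * fockMap N Z t u) i j =
      t⁻¹ ^ q.word.length * (wordEval Z (k :: q.word) *ᵥ u) i := by
    rw [wordEval_cons, ← Matrix.mulVec_mulVec, Matrix.mul_apply, Matrix.mulVec, dotProduct,
      Finset.mul_sum]
    refine Finset.sum_congr rfl fun l _ => ?_
    rw [fockMap, Matrix.of_apply, ← hq]
    ring
  rw [hR, Matrix.mul_apply]
  by_cases hlen : (k :: q.word).length < N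
  · obtain ⟨p, hp⟩ := FockIndex.exists_word_eq hlen
    rw [Finset.sum_eq_single (Fintype.equivFin _ p)]
    · have hlen' : (p.1 : ℕ) = q.1 + 1 := by
        rw [← p.length_word, hp, List.length_cons, q.length_word]
      simp [fockMap, creation, ← hq, hp, hlen']
      field_simp
      ring
    · intro r _ hr
      have : ((Fintype.equivFin (FockIndex d N)).symm r).word ≠ k :: q.word := by
        rw [← hp]
        intro h
        exact hr ((Equiv.symm_apply_eq _).1 (FockIndex.word_injective h))
      simp [creation, ← hq, this]
    · simp
  · rw [hZ _ (not_lt.1 hlen)]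
    simp only [Matrix.zero_mulVec, Pi.zero_apply, mul_zero]
    refine Finset.sum_eq_zero fun r _ => ?_
    have : ((Fintype.equivFin (FockIndex d N)).symm r).word ≠ k :: q.word := by
      intro h
      have h1 := ((Fintype.equivFin (FockIndex d N)).symm r).1.2
      rw [← FockIndex.length_word, h] at h1
      exact hlen h1
    simp [creation, ← hq, this]

theorem partialSum_colOp_apply {n : ℕ} (Z : MatTuple d n) (T : FormalSeries d (X →L[ℂ] Y)) (N : ℕ)
    (x : X) (u : Amp ℂ n) (i : Fin n) :
    partialSum Z T N (colOp n x u) i =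
      ∑ p : FockIndex d N, (wordEval Z p.word *ᵥ u.ofLp) i • T p.word x := by
  rw [← sum_words_eq_sum_fockIndex fun a => (wordEval Z a *ᵥ u.ofLp) i • T a x]
  simp only [partialSum, sum_apply, WithLp.ofLp_sum, Finset.sum_apply,
    tensorOp_apply, colOp_apply, map_smul, smul_smul, Matrix.mulVec, dotProduct, Finset.sum_smul]

/-- On jointly nilpotent points of a fixed order, a nc function is a polynomial, with the
coefficients read off from its value at the creation operators. -/
theorem IsNCFunction.exists_eq_partialSum {Ω : NCDomain d} {F : NCMap Ω X Y} (hF : IsNCFunction F)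
    {N : ℕ} (hN : 0 < N) (hΩ : ∃ t : ℂ, t ≠ 0 ∧ t • creation d N ∈ Ω _) :
    ∃ T : FormalSeries d (X →L[ℂ] Y), ∀ (n : ℕ) (Z : Ω n),
      (∀ a : Word d, N ≤ a.length → wordEval Z.1 a = 0) → F n Z = partialSum Z.1 T N := by
  obtain ⟨t, ht, hmem⟩ := hΩ
  obtain ⟨o, ho⟩ := FockIndex.exists_word_eq (d := d) (a := []) hN
  let e := Fintype.equivFin (FockIndex d N)
  let G : FockIndex d N → X →L[ℂ] Y := fun p =>
    t⁻¹ ^ p.word.length • blockEntry (F _ ⟨_, hmem⟩) (e p) (e o)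
  refine ⟨Function.extend FockIndex.word G 0, fun n Z hZ => ext_colOp fun x => ?_⟩
  ext u i
  have h1 := DFunLike.congr_fun (hF _ _ ⟨_, hmem⟩ Z (fockMap N Z.1 t u.ofLp)
    (fockMap_mul_creation hZ ht u.ofLp)) (colOp _ x (EuclideanSpace.single (e o) 1))
  have h2 : scalarOp ℂ (fockMap N Z.1 t u.ofLp) (EuclideanSpace.single (e o) 1) = u := by
    have ho' : (o.1 : ℕ) = 0 := by rw [← o.length_word, ho, List.length_nil]
    ext l
    simp [scalarOp, tensorOp_apply, fockMap, e, ho, ho', wordEval_nil]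
  simp only [ContinuousLinearMap.comp_apply] at h1 ⊢
  rw [← ContinuousLinearMap.comp_apply (scalarOp X _), scalarOp_comp_colOp,
    ContinuousLinearMap.comp_apply, h2] at h1
  rw [← h1, partialSum_colOp_apply, scalarOp, tensorOp_apply, ← e.sum_comp]
  refine Finset.sum_congr rfl fun p _ => ?_
  rw [FockIndex.word_injective.extend_apply, ContinuousLinearMap.id_apply, ← blockEntry_apply]
  simp [fockMap, G, smul_smul, e, mul_comm]

theorem wordEval_bidiagonal_apply (a b : Word d) (i j : Fin (a.length + 1)) :
    wordEval (bidiagonal a) b i j =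
      if b <+: a.drop i ∧ (j : ℕ) = i + b.length then 1 else 0 := by
  induction b generalizing i with
  | nil => simp [wordEval_nil, Matrix.one_apply, Fin.ext_iff, eq_comm]
  | cons k b ih =>
    rw [wordEval_cons, Matrix.mul_apply]
    by_cases hi : (i : ℕ) < a.length
    · rw [Finset.sum_eq_single ⟨i + 1, by lia⟩]
      · have h1 : k :: b <+: a.drop i ↔ a[(i : ℕ)] = k ∧ b <+: a.drop (i + 1) := by
          rw [List.drop_eq_getElem_cons hi, List.cons_prefix_cons, eq_comm]
        have h2 : (i : ℕ) + (b.length + 1) = i + 1 + b.length := by lia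
        rw [ih]
        simp only [bidiagonal, Matrix.of_apply, true_and, List.length_cons,
          List.getElem?_eq_getElem hi, Option.some.injEq, h1, h2, ite_mul, one_mul, zero_mul,
          and_assoc]
        rw [← ite_and]
      · intro r _ hr
        have : (r : ℕ) ≠ i + 1 := fun h => hr (Fin.ext h)
        simp [bidiagonal, this]
      · simp
    · have h1 : a.drop i = [] := List.drop_eq_nil_of_le (by lia)
      rw [h1]
      simp only [List.prefix_nil, reduceCtorEq, false_and, if_false]
      refine Finset.sum_eq_zero fun r _ => ?_
      have : a[(i : ℕ)]? = none := List.getElem?_eq_none (by lia)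
      simp [bidiagonal, this]

theorem wordEval_bidiagonal_corner (a b : Word d) :
    wordEval (bidiagonal a) b 0 (Fin.last a.length) = if b = a then 1 else 0 := by
  rw [wordEval_bidiagonal_apply]
  refine if_congr ⟨?_, ?_⟩ rfl rfl
  · rintro ⟨h1, h2⟩
    refine List.IsPrefix.eq_of_length (by simpa using h1) ?_
    simpa using h2.symm
  · rintro rfl
    simp

theorem wordEval_bidiagonal_eq_zero {a b : Word d} (h : a.length < b.length) :
    wordEval (bidiagonal a) b = 0 := by
  ext i j
  rw [wordEval_bidiagonal_apply, if_neg, Matrix.zero_apply]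
  rintro ⟨-, h2⟩
  have := j.2
  lia

theorem blockEntry_partialSum_bidiagonal (t : ℂ) (a : Word d) (T : FormalSeries d (X →L[ℂ] Y))
    {N : ℕ} (hN : a.length < N) :
    blockEntry (partialSum (t • bidiagonal a) T N) 0 (Fin.last a.length) = t ^ a.length • T a := by
  rw [partialSum, sum_words_eq_sum_fockIndex
    fun b => tensorOp (wordEval (t • bidiagonal a) b) (T b), blockEntry_sum]
  simp only [blockEntry_tensorOp, wordEval_smul, Matrix.smul_apply, wordEval_bidiagonal_corner]
  obtain ⟨p, hp⟩ := FockIndex.exists_word_eq hN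
  rw [Finset.sum_eq_single p]
  · simp [hp]
  · intro q _ hq
    rw [if_neg fun h => hq (FockIndex.word_injective (h.trans hp.symm)), smul_zero, zero_smul]
  · simp

theorem taylorCoeff_eq {Ω : NCDomain d} {F : NCMap Ω X Y} {T : FormalSeries d (X →L[ℂ] Y)}
    {a : Word d} (hΩ : ∃ t : ℂ, t ≠ 0 ∧ t • bidiagonal a ∈ Ω (a.length + 1)) {N : ℕ}
    (hN : a.length < N)
    (h : ∀ Z : Ω (a.length + 1), (∃ t : ℂ, Z.1 = t • bidiagonal a) →
      F (a.length + 1) Z = partialSum Z.1 T N) : taylorCoeff F a = T a := by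
  rw [taylorCoeff, dif_pos hΩ, h _ ⟨_, rfl⟩, blockEntry_partialSum_bidiagonal _ _ _ hN, smul_smul,
    inv_mul_cancel₀ (pow_ne_zero _ hΩ.choose_spec.1), one_smul]

/-- Every jointly nilpotent point of positive size has a nonzero multiple in `Ω`. -/
def AbsorbsNilp (Ω : NCDomain d) : Prop :=
  ∀ n, 0 < n → ∀ Z ∈ Nilp d n, ∃ t : ℂ, t ≠ 0 ∧ t • Z ∈ Ω n

theorem bidiagonal_mem_nilp (a : Word d) : bidiagonal a ∈ Nilp d (a.length + 1) :=
  ⟨a.length + 1, fun _ hb => wordEval_bidiagonal_eq_zero hb⟩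

theorem AbsorbsNilp.bidiagonal {Ω : NCDomain d} (hΩ : AbsorbsNilp Ω) (a : Word d) :
    ∃ t : ℂ, t ≠ 0 ∧ t • bidiagonal a ∈ Ω (a.length + 1) :=
  hΩ _ (Nat.succ_pos _) _ (bidiagonal_mem_nilp a)

/-- A nc function is given by its Taylor polynomials at the jointly nilpotent points. -/
theorem IsNCFunction.eq_partialSum_taylorCoeff {Ω : NCDomain d} {F : NCMap Ω X Y}
    (hF : IsNCFunction F) (hΩ : AbsorbsNilp Ω) {N : ℕ} (hN : 0 < N) {n : ℕ} (Z : Ω n)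
    (hZ : ∀ a : Word d, N ≤ a.length → wordEval Z.1 a = 0) :
    F n Z = partialSum Z.1 (taylorCoeff F) N := by
  obtain ⟨T, hT⟩ := hF.exists_eq_partialSum hN
    (hΩ _ (Fintype.card_pos_iff.2 ⟨⟨⟨0, hN⟩, Fin.elim0⟩⟩) _
      ⟨N, fun _ => wordEval_creation_eq_zero⟩)
  rw [hT n Z hZ, partialSum, partialSum,
    sum_words_eq_sum_fockIndex fun b => tensorOp (wordEval Z.1 b) (T b),
    sum_words_eq_sum_fockIndex fun b => tensorOp (wordEval Z.1 b) (taylorCoeff F b)]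
  refine Finset.sum_congr rfl fun p _ => ?_
  have hp : p.word.length < N := p.length_word ▸ p.1.2
  rw [taylorCoeff_eq (hΩ.bidiagonal _) hp]
  rintro W ⟨t, ht⟩
  refine hT _ W fun b hb => ?_
  rw [ht, wordEval_smul, wordEval_bidiagonal_eq_zero (hp.trans_le hb), smul_zero]

theorem IsNCFunction.hasSeriesSum_of_mem_nilp {Ω : NCDomain d} {F : NCMap Ω X Y}
    (hF : IsNCFunction F) (hΩ : AbsorbsNilp Ω) {n : ℕ} (Z : Ω n) (hZ : Z.1 ∈ Nilp d n) :
    HasSeriesSum Z.1 (taylorCoeff F) (F n Z) := by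
  obtain ⟨N, hN⟩ := hZ
  exact hasSeriesSum_of_eventually_eq (N + 1) fun M hM =>
    (hF.eq_partialSum_taylorCoeff hΩ (by lia) Z fun a ha => hN a (by lia)).symm

/-- At a multiple of a bidiagonal tuple the sum of a series is a polynomial whose upper right corner
is a multiple of a coefficient. -/
theorem HasSeriesSum.blockEntry_bidiagonal {t : ℂ} {a : Word d} {T : FormalSeries d (X →L[ℂ] Y)}
    {S : Amp X (a.length + 1) →L[ℂ] Amp Y (a.length + 1)}
    (h : HasSeriesSum (t • bidiagonal a) T S) :
    blockEntry S 0 (Fin.last a.length) = t ^ a.length • T a := by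
  rw [← blockEntry_partialSum_bidiagonal t a T (Nat.lt_succ_self _)]
  congr 1
  refine h.unique (hasSeriesSum_of_eventually_eq (a.length + 1) fun M hM => ?_)
  rw [partialSum_eq, partialSum_eq]
  refine (Finset.sum_subset (Finset.range_mono hM) fun ℓ _ hℓ => ?_).symm
  refine Finset.sum_eq_zero fun b _ => ?_
  rw [wordEval_smul, wordEval_bidiagonal_eq_zero, smul_zero, tensorOp_zero_left]
  simpa using hℓ

/-! ### Analyticity along slices -/

open Classical in
/-- The extension by zero of a level of a graded function to all tuples of matrices. -/
def zeroExt {Ω : NCDomain d} (F : NCMap Ω X Y) {n : ℕ} (Z : MatTuple d n) :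
    Amp X n →L[ℂ] Amp Y n :=
  if h : Z ∈ Ω n then F n ⟨Z, h⟩ else 0

theorem zeroExt_of_mem {Ω : NCDomain d} (F : NCMap Ω X Y) {n : ℕ} {Z : MatTuple d n}
    (h : Z ∈ Ω n) : zeroExt F Z = F n ⟨Z, h⟩ :=
  dif_pos h

/-- Local boundedness, along slices, of the matrix coefficients of a graded function. -/
def IsSliceBounded {Ω : NCDomain d} (F : NCMap Ω X Y) : Prop :=
  ∀ (n : ℕ), ∀ Z ∈ Ω n, ∀ (D : MatTuple d n) (ξ : Amp X n) (φ : StrongDual ℂ (Amp Y n)), ∃ C : ℝ,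
    ∀ᶠ t : ℂ in 𝓝 0, ‖φ (zeroExt F (Z + t • D) ξ)‖ ≤ C

theorem IsFinitelyOpen.eventually {Ω : NCDomain d} (hΩ : IsFinitelyOpen Ω) {n : ℕ}
    {Z : MatTuple d n} (hZ : Z ∈ Ω n) (D : MatTuple d n) :
    ∀ᶠ t : ℂ in 𝓝 0, Z + t • D ∈ Ω n := by
  obtain ⟨ε, hε, h⟩ := hΩ n Z hZ D
  rw [Metric.eventually_nhds_iff]
  exact ⟨ε, hε, fun t ht => h t (by simpa using ht)⟩

theorem IsNCFunction.zeroExt_intertwine {Ω : NCDomain d} {F : NCMap Ω X Y} (hF : IsNCFunction F)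
    {n m : ℕ} {Z : MatTuple d n} {Z' : MatTuple d m} (hZ : Z ∈ Ω n) (hZ' : Z' ∈ Ω m)
    {α : Matrix (Fin m) (Fin n) ℂ} (h : ∀ k, α * Z k = Z' k * α) :
    scalarOp Y α ∘L zeroExt F Z = zeroExt F Z' ∘L scalarOp X α := by
  rw [zeroExt_of_mem F hZ, zeroExt_of_mem F hZ']
  exact hF n m ⟨Z, hZ⟩ ⟨Z', hZ'⟩ α h

/-- The block upper triangular tuple with diagonal `A`, `D` and upper right corner `B`. -/
def upperBlock {n : ℕ} (A B D : MatTuple d n) : MatTuple d (n + n) := fun k =>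
  inlMat n n * A k * (inlMat n n)ᵀ + inlMat n n * B k * (inrMat n n)ᵀ +
    inrMat n n * D k * (inrMat n n)ᵀ

theorem directSum_add_smul_upperBlock {n : ℕ} (A B D : MatTuple d n) (c : ℂ) :
    directSum A D + c • upperBlock 0 B 0 = upperBlock A (c • B) D := by
  funext k
  simp only [Pi.add_apply, Pi.smul_apply, directSum_eq, upperBlock, Pi.zero_apply, Matrix.mul_zero,
    Matrix.zero_mul, zero_add, add_zero, Matrix.mul_smul, Matrix.smul_mul]
  abel

theorem upperBlock_add_smul_upperBlock {n : ℕ} (A B D E : MatTuple d n) (t : ℂ) :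
    upperBlock A B D + t • upperBlock E 0 0 = upperBlock (A + t • E) B D := by
  funext k
  simp only [Pi.add_apply, Pi.smul_apply, upperBlock, Pi.zero_apply, Matrix.mul_zero,
    Matrix.zero_mul, add_zero, Matrix.mul_smul, Matrix.smul_mul, Matrix.mul_add, Matrix.add_mul]
  abel

theorem upperBlock_mul_inlMat {n : ℕ} (A B D : MatTuple d n) (k : Fin d) :
    upperBlock A B D k * inlMat n n = inlMat n n * A k := by
  simp only [upperBlock, Matrix.add_mul, Matrix.mul_assoc, inlMat_mul_inlMat, inrMat_mul_inlMat,
    Matrix.mul_zero, Matrix.mul_one, add_zero]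

theorem upperBlock_mul_inrMat {n : ℕ} (A B D : MatTuple d n) (k : Fin d) :
    upperBlock A B D k * inrMat n n = inlMat n n * B k + inrMat n n * D k := by
  simp only [upperBlock, Matrix.add_mul, Matrix.mul_assoc, inlMat_mul_inrMat, inrMat_mul_inrMat,
    Matrix.mul_zero, Matrix.mul_one, zero_add]

/-- The upper right corner of the value of a nc function at `[[Z + tD, cD], [0, Z]]` is a difference
quotient. -/
theorem IsNCFunction.smul_sub_eq_corner {Ω : NCDomain d} {F : NCMap Ω X Y} (hF : IsNCFunction F)
    {n : ℕ} {Z D : MatTuple d n} {t c : ℂ} (ht : t ≠ 0) (hZ : Z ∈ Ω n) (hZt : Z + t • D ∈ Ω n)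
    (hT : upperBlock (Z + t • D) (c • D) Z ∈ Ω (n + n)) :
    (c / t) • (zeroExt F (Z + t • D) - zeroExt F Z) =
      scalarOp Y (inlMat n n)ᵀ ∘L zeroExt F (upperBlock (Z + t • D) (c • D) Z) ∘L
        scalarOp X (inrMat n n) := by
  set T := upperBlock (Z + t • D) (c • D) Z with hTdef
  have h1 := hF.zeroExt_intertwine hZt hT (α := inlMat n n)
    fun k => (upperBlock_mul_inlMat _ _ _ k).symm
  have h2 := hF.zeroExt_intertwine hZ hT (α := -(c / t) • inlMat n n + inrMat n n) fun k => by
    rw [Matrix.mul_add, Matrix.mul_smul, hTdef, upperBlock_mul_inlMat, upperBlock_mul_inrMat]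
    simp only [Pi.add_apply, Pi.smul_apply, Matrix.mul_add, Matrix.mul_smul, Matrix.add_mul,
      smul_add, smul_smul, neg_mul, div_mul_cancel₀ _ ht, neg_smul, Matrix.smul_mul,
      Matrix.neg_mul]
    abel
  have h3 : scalarOp Y (inlMat n n)ᵀ ∘L scalarOp Y (inlMat n n) = ContinuousLinearMap.id ℂ _ := by
    rw [← scalarOp_mul, inlMat_mul_inlMat, scalarOp_one]
  have h4 : scalarOp Y (inlMat n n)ᵀ ∘L scalarOp Y (inrMat n n) = 0 := by
    rw [← scalarOp_mul, inlMat_mul_inrMat, scalarOp_zero]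
  simp only [scalarOp_add, scalarOp_smul, ContinuousLinearMap.comp_add,
    ContinuousLinearMap.add_comp, ContinuousLinearMap.comp_smul, ContinuousLinearMap.smul_comp,
    ← h1] at h2
  have h5 := congrArg (fun S => scalarOp Y (inlMat n n)ᵀ ∘L S) h2
  simp only [ContinuousLinearMap.comp_add, ContinuousLinearMap.comp_smul,
    ← ContinuousLinearMap.comp_assoc, h3, h4, ContinuousLinearMap.id_comp,
    ContinuousLinearMap.zero_comp, add_zero] at h5
  ext1 ξ
  have h6 := DFunLike.congr_fun h5 ξ
  rw [← ContinuousLinearMap.comp_assoc]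
  simp only [add_apply, smul_apply, sub_apply, neg_smul] at h6 ⊢
  rw [smul_sub, sub_eq_add_neg, h6]
  abel

section Slice

variable {Ω : NCDomain d} (hΩ : IsNCSet Ω) (hopen : IsFinitelyOpen Ω) {F : NCMap Ω X Y}
  (hF : IsNCFunction F) (hb : IsSliceBounded F)
include hΩ hopen hF

/-- Near every point of `Ω`, the difference quotients of a matrix coefficient of a nc function along
a slice are matrix coefficients of its values along a slice in `Ω_{2n}`. -/
theorem IsNCFunction.exists_differenceQuotient {n : ℕ} {Z : MatTuple d n} (hZ : Z ∈ Ω n)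
    (D : MatTuple d n) (ξ : Amp X n) (φ : StrongDual ℂ (Amp Y n)) :
    ∃ (W E : MatTuple d (n + n)) (ξ' : Amp X (n + n)) (φ' : StrongDual ℂ (Amp Y (n + n))),
      W ∈ Ω (n + n) ∧ ∀ᶠ t : ℂ in 𝓝 0, t ≠ 0 →
        t⁻¹ • (φ (zeroExt F (Z + t • D) ξ) - φ (zeroExt F Z ξ)) =
          φ' (zeroExt F (W + t • E) ξ') := by
  obtain ⟨c, hc, hW⟩ := (((hopen.eventually (hΩ n n Z Z hZ hZ) (upperBlock 0 D 0)).filter_mono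
    nhdsWithin_le_nhds).and (self_mem_nhdsWithin (s := {0}ᶜ))).exists.imp fun c h => h.symm
  rw [directSum_add_smul_upperBlock] at hW
  refine ⟨_, upperBlock D 0 0, scalarOp X (inrMat n n) ξ, c⁻¹ • (φ ∘L scalarOp Y (inlMat n n)ᵀ),
    hW, ?_⟩
  filter_upwards [hopen.eventually hW (upperBlock D 0 0), hopen.eventually hZ D] with t h1 h2 ht
  rw [upperBlock_add_smul_upperBlock] at h1 ⊢
  have h3 := congrArg φ (DFunLike.congr_fun (hF.smul_sub_eq_corner ht hZ h2 h1) ξ)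
  simp only [ContinuousLinearMap.comp_apply, smul_apply, sub_apply, map_smul, map_sub] at h3 ⊢
  have : c ≠ 0 := hc
  rw [← h3, smul_smul]
  congr 1
  field_simp

include hb

theorem IsNCFunction.exists_norm_sub_le {n : ℕ} {Z : MatTuple d n} (hZ : Z ∈ Ω n)
    (D : MatTuple d n) (ξ : Amp X n) (φ : StrongDual ℂ (Amp Y n)) :
    ∃ C : ℝ, ∀ᶠ t : ℂ in 𝓝 0,
      ‖φ (zeroExt F (Z + t • D) ξ) - φ (zeroExt F Z ξ)‖ ≤ C * ‖t‖ := by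
  obtain ⟨W, E, ξ', φ', hW, h⟩ := hF.exists_differenceQuotient hΩ hopen hZ D ξ φ
  obtain ⟨C, hC⟩ := hb _ W hW E ξ' φ'
  refine ⟨C, ?_⟩
  filter_upwards [h, hC] with t h1 h2
  rcases eq_or_ne t 0 with rfl | ht
  · simp
  · rwa [← div_le_iff₀ (norm_pos_iff.2 ht), div_eq_inv_mul, ← norm_inv, ← norm_smul, h1 ht]

theorem IsNCFunction.tendsto_slice {n : ℕ} {Z : MatTuple d n} (hZ : Z ∈ Ω n) (D : MatTuple d n)
    (ξ : Amp X n) (φ : StrongDual ℂ (Amp Y n)) :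
    Tendsto (fun t : ℂ => φ (zeroExt F (Z + t • D) ξ)) (𝓝 0) (𝓝 (φ (zeroExt F Z ξ))) := by
  obtain ⟨C, hC⟩ := hF.exists_norm_sub_le hΩ hopen hb hZ D ξ φ
  rw [tendsto_iff_norm_sub_tendsto_zero]
  refine squeeze_zero' (Eventually.of_forall fun t => norm_nonneg _) hC ?_
  have : Tendsto (fun t : ℂ => C * ‖t‖) (𝓝 0) (𝓝 (C * ‖(0 : ℂ)‖)) :=
    (Continuous.tendsto (by fun_prop) _)
  simpa using this

/-- A nc function that is locally bounded along slices is analytic along slices. -/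
theorem IsNCFunction.differentiableAt_slice {n : ℕ} {Z D : MatTuple d n} {t : ℂ}
    (hZ : Z + t • D ∈ Ω n) (ξ : Amp X n) (φ : StrongDual ℂ (Amp Y n)) :
    DifferentiableAt ℂ (fun t : ℂ => φ (zeroExt F (Z + t • D) ξ)) t := by
  obtain ⟨W, E, ξ', φ', hW, h⟩ := hF.exists_differenceQuotient hΩ hopen hZ D ξ φ
  have hlim := (hF.tendsto_slice hΩ hopen hb hW E ξ' φ').mono_left
    (nhdsWithin_le_nhds (s := ({0} : Set ℂ)ᶜ))
  refine (hasDerivAt_iff_tendsto_slope_zero.2 (hlim.congr' ?_)).differentiableAt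
  filter_upwards [h.filter_mono nhdsWithin_le_nhds, self_mem_nhdsWithin] with s h1 h2
  rw [add_smul, ← add_assoc, h1 h2]

end Slice

/-! ### Taylor expansion along complex lines -/

/-- The `N × N` matrix of the cyclic shift with the weight `s` on its last arc; for `s = 0` it is
nilpotent, and for `s = r^N` it has the eigenvector `(1, r, …, r^{N-1})` with the eigenvalue `r`. -/
def weightedShift (N : ℕ) (s : ℂ) : Matrix (Fin N) (Fin N) ℂ :=
  Matrix.of fun i j => if (j : ℕ) = i + 1 then 1 else if (i : ℕ) + 1 = N ∧ (j : ℕ) = 0 then s else 0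

theorem weightedShift_mulVec {N : ℕ} (s : ℂ) (f : ℕ → ℂ) (i : Fin N) :
    (weightedShift N s *ᵥ fun j : Fin N => f j) i =
      if (i : ℕ) + 1 < N then f (i + 1) else s * f 0 := by
  have hN : 0 < N := i.pos
  rw [Matrix.mulVec, dotProduct]
  split_ifs with h
  · rw [Finset.sum_eq_single ⟨i + 1, h⟩]
    · simp [weightedShift]
    · intro j _ hj
      have h1 : (j : ℕ) ≠ i + 1 := fun h' => hj (Fin.ext h')
      have h2 : (i : ℕ) + 1 ≠ N := h.ne
      simp [weightedShift, h1, h2]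
    · simp
  · have hi : (i : ℕ) + 1 = N := by lia
    rw [Finset.sum_eq_single ⟨0, hN⟩]
    · simp [weightedShift, hi, hN.ne]
    · intro j _ hj
      have h1 : (j : ℕ) ≠ i + 1 := by lia
      have h2 : (j : ℕ) ≠ 0 := fun h' => hj (Fin.ext h')
      simp [weightedShift, h1, h2]
    · simp

theorem weightedShift_mulVec_pow {N : ℕ} (r : ℂ) :
    (weightedShift N (r ^ N) *ᵥ fun j : Fin N => r ^ (j : ℕ)) =
      r • fun j : Fin N => r ^ (j : ℕ) := by
  funext i
  rw [weightedShift_mulVec _ fun j => r ^ j, Pi.smul_apply, smul_eq_mul, ← pow_succ', pow_zero,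
    mul_one]
  split_ifs with h
  · rfl
  · have hi : (i : ℕ) + 1 = N := by lia
    rw [hi]

theorem weightedShift_zero_pow_mulVec {N : ℕ} (ℓ : ℕ) (f : ℕ → ℂ) :
    (weightedShift N 0 ^ ℓ *ᵥ fun j : Fin N => f j) =
      fun i : Fin N => if (i : ℕ) + ℓ < N then f (i + ℓ) else 0 := by
  induction ℓ with
  | zero =>
    funext i
    simp
  | succ ℓ ih =>
    funext i
    rw [pow_succ', ← Matrix.mulVec_mulVec, ih,
      weightedShift_mulVec 0 fun j => if j + ℓ < N then f (j + ℓ) else 0, zero_mul]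
    have h : (i : ℕ) + 1 + ℓ = i + (ℓ + 1) := by lia
    rw [h]
    split_ifs <;> first | rfl | lia

/-- The Kronecker products of the matrices of the tuple `Z` with the matrix `S`. -/
def kronTuple {n N : ℕ} (Z : MatTuple d n) (S : Matrix (Fin N) (Fin N) ℂ) : MatTuple d (n * N) :=
  fun k => Matrix.of fun p q => Z k (finProdFinEquiv.symm p).1 (finProdFinEquiv.symm q).1 *
    S (finProdFinEquiv.symm p).2 (finProdFinEquiv.symm q).2

/-- The matrix of `u ↦ u ⊗ v`. -/
def kronCol (n : ℕ) {N : ℕ} (v : Fin N → ℂ) : Matrix (Fin (n * N)) (Fin n) ℂ :=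
  Matrix.of fun p i => if (finProdFinEquiv.symm p).1 = i then v (finProdFinEquiv.symm p).2 else 0

theorem kronTuple_mul_kronCol {n N : ℕ} (Z : MatTuple d n) (S : Matrix (Fin N) (Fin N) ℂ)
    (v : Fin N → ℂ) (k : Fin d) :
    kronTuple Z S k * kronCol n v = kronCol n (S *ᵥ v) * Z k := by
  ext p i
  rw [Matrix.mul_apply, Matrix.mul_apply, ← finProdFinEquiv.sum_comp, Fintype.sum_prod_type]
  simp only [kronTuple, kronCol, Matrix.of_apply, Equiv.symm_apply_apply, mul_ite, mul_zero,
    Finset.sum_ite_irrel, Finset.sum_const_zero, Finset.sum_ite_eq', Finset.mem_univ, if_true,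
    ite_mul, zero_mul, Finset.sum_ite_eq, Matrix.mulVec, dotProduct, Finset.sum_mul]
  exact Finset.sum_congr rfl fun j _ => by ring

theorem wordEval_kronTuple_mul_kronCol {n N : ℕ} (Z : MatTuple d n) (S : Matrix (Fin N) (Fin N) ℂ)
    (v : Fin N → ℂ) (a : Word d) :
    wordEval (kronTuple Z S) a * kronCol n v = kronCol n (S ^ a.length *ᵥ v) * wordEval Z a := by
  induction a with
  | nil => simp [wordEval_nil]
  | cons k a ih =>
    rw [wordEval_cons, wordEval_cons, Matrix.mul_assoc, ih, ← Matrix.mul_assoc,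
      kronTuple_mul_kronCol, Matrix.mul_assoc, Matrix.mulVec_mulVec, List.length_cons, pow_succ']

theorem kronCol_smul (n : ℕ) {N : ℕ} (c : ℂ) (v : Fin N → ℂ) :
    kronCol n (c • v) = c • kronCol n v := by
  ext p i
  simp [kronCol]

theorem kronCol_zero (n : ℕ) {N : ℕ} : kronCol n (0 : Fin N → ℂ) = 0 := by
  ext p i
  simp [kronCol]

theorem kronCol_transpose_mul_kronCol (n : ℕ) {N : ℕ} (i : Fin N) (v : Fin N → ℂ) :
    (kronCol n (Pi.single i 1))ᵀ * kronCol n v = v i • 1 := by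
  ext p q
  rw [Matrix.mul_apply, ← finProdFinEquiv.sum_comp, Fintype.sum_prod_type]
  simp only [kronCol, Matrix.transpose_apply, Matrix.of_apply, Equiv.symm_apply_apply]
  simp [Matrix.one_apply, Pi.single_apply, eq_comm]

theorem eq_zero_of_mul_kronCol {m n N : ℕ} {A : Matrix (Fin m) (Fin (n * N)) ℂ}
    (h : ∀ f : ℕ → ℂ, A * kronCol n (fun j : Fin N => f j) = 0) : A = 0 := by
  ext p q
  obtain ⟨⟨i, j⟩, rfl⟩ := finProdFinEquiv.surjective q
  have h1 := congrFun (congrFun (h fun l => if l = j then 1 else 0) p) i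
  rw [Matrix.mul_apply, ← finProdFinEquiv.sum_comp, Fintype.sum_prod_type] at h1
  simp only [kronCol, Matrix.of_apply, Equiv.symm_apply_apply] at h1
  simpa [← Fin.ext_iff] using h1

theorem wordEval_kronTuple_weightedShift_zero {n N : ℕ} (Z : MatTuple d n) {a : Word d}
    (ha : N ≤ a.length) : wordEval (kronTuple Z (weightedShift N 0)) a = 0 := by
  refine eq_zero_of_mul_kronCol fun f => ?_
  rw [wordEval_kronTuple_mul_kronCol, weightedShift_zero_pow_mulVec]
  have : (fun i : Fin N => if (i : ℕ) + a.length < N then f (i + a.length) else 0) = 0 := by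
    funext i
    rw [if_neg (by lia), Pi.zero_apply]
  rw [this, kronCol_zero, Matrix.zero_mul]

theorem kronTuple_weightedShift {n N : ℕ} (Z : MatTuple d n) (s : ℂ) :
    kronTuple Z (weightedShift N s) = kronTuple Z (weightedShift N 0) +
      s • kronTuple Z (weightedShift N 1 - weightedShift N 0) := by
  funext k
  ext p q
  simp only [kronTuple, weightedShift, Matrix.of_apply, Pi.add_apply, Pi.smul_apply,
    Matrix.add_apply, Matrix.smul_apply, Matrix.sub_apply, smul_eq_mul]
  split_ifs <;> ring

theorem kronCol_eq_sum (n : ℕ) {N : ℕ} (v : Fin N → ℂ) :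
    kronCol n v = ∑ j, v j • kronCol n (Pi.single j 1) := by
  ext p i
  simp only [kronCol, Matrix.sum_apply, Matrix.smul_apply, Matrix.of_apply]
  simp [Pi.single_apply]

theorem scalarOp_kronCol_apply {n N : ℕ} (v : Fin N → ℂ) (ξ : Amp X n) :
    scalarOp X (kronCol n v) ξ = ∑ j, v j • scalarOp X (kronCol n (Pi.single j 1)) ξ := by
  ext i
  rw [kronCol_eq_sum]
  simp only [scalarOp, tensorOp_apply, WithLp.ofLp_sum, Finset.sum_apply, Matrix.sum_apply,
    Matrix.smul_apply, PiLp.smul_apply, Finset.sum_smul, Finset.smul_sum, smul_assoc]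
  exact Finset.sum_comm

/-- Compressing a series at the nilpotent point `c Z ⊗ S` to the vectors `u ⊗ (1, r, r², …)` gives
the Taylor polynomials at the point `c r Z`. -/
theorem scalarOp_comp_partialSum_kronTuple {n N : ℕ} (hN : 0 < N) (Z : MatTuple d n) (c r : ℂ)
    (T : FormalSeries d (X →L[ℂ] Y)) :
    scalarOp Y (kronCol n (Pi.single (⟨0, hN⟩ : Fin N) 1))ᵀ ∘L
      partialSum (c • kronTuple Z (weightedShift N 0)) T N ∘L
        scalarOp X (kronCol n fun j : Fin N => r ^ (j : ℕ)) = partialSum ((c * r) • Z) T N := by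
  simp only [partialSum, ContinuousLinearMap.comp_finsetSum, ContinuousLinearMap.finsetSum_comp,
    scalarOp_comp_tensorOp, tensorOp_comp_scalarOp]
  refine Finset.sum_congr rfl fun ℓ hℓ => Finset.sum_congr rfl fun a _ => ?_
  have hℓ' : ℓ < N := Finset.mem_range.1 hℓ
  congr 1
  rw [wordEval_smul, wordEval_smul, Matrix.smul_mul, Matrix.mul_smul,
    wordEval_kronTuple_mul_kronCol, ← Matrix.mul_assoc, kronCol_transpose_mul_kronCol,
    weightedShift_zero_pow_mulVec _ fun j => r ^ j, Matrix.smul_mul, Matrix.one_mul, smul_smul,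
    mul_pow, List.length_ofFn]
  simp only [zero_add, if_pos hℓ']

section Taylor

variable {Ω : NCDomain d} (hΩ : IsNCSet Ω) (hopen : IsFinitelyOpen Ω) {F : NCMap Ω X Y}
  (hF : IsNCFunction F) (hb : IsSliceBounded F) (hΩ' : AbsorbsNilp Ω)
include hΩ hopen hF hb hΩ'

/-- The Taylor polynomials of a nc function approximate it along complex lines through `0`. The
matrix `r Z` is the compression of `Z ⊗ S` to an eigenspace of the weighted shift `S` with weight
`r ^ N`, which is a perturbation of order `r ^ N` of the nilpotent shift. -/
theorem IsNCFunction.isBigO_sub_partialSum {n N : ℕ} (hn : 0 < n) (hN : 0 < N) (Z : MatTuple d n)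
    (ξ : Amp X n) (φ : StrongDual ℂ (Amp Y n)) :
    (fun t : ℂ => φ (zeroExt F (t • Z) ξ) - φ (partialSum (t • Z) (taylorCoeff F) N ξ))
      =O[𝓝 0] fun t : ℂ => t ^ N := by
  set W := kronTuple Z (weightedShift N 0) with hWdef
  have hWnil : ∀ a : Word d, N ≤ a.length → wordEval W a = 0 := fun a ha =>
    wordEval_kronTuple_weightedShift_zero Z ha
  obtain ⟨c, hc, hcW⟩ := hΩ' _ (Nat.mul_pos hn hN) W ⟨N, hWnil⟩
  set D := c • kronTuple Z (weightedShift N 1 - weightedShift N 0) with hDdef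
  have hD : ∀ s : ℂ, c • W + s • D = c • kronTuple Z (weightedShift N s) := fun s => by
    rw [kronTuple_weightedShift, smul_add, hDdef, smul_comm s c]
  have h0 : (0 : MatTuple d n) ∈ Ω n := by
    obtain ⟨t, -, ht⟩ := hΩ' n hn 0 ⟨1, fun a ha => by
      obtain _ | ⟨k, a⟩ := a
      · simp at ha
      · rw [wordEval_cons, Pi.zero_apply, Matrix.zero_mul]⟩
    rwa [smul_zero] at ht
  let φ' : StrongDual ℂ (Amp Y (n * N)) :=
    φ ∘L scalarOp Y (kronCol n (Pi.single (⟨0, hN⟩ : Fin N) 1))ᵀ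
  let ξ' : Fin N → Amp X (n * N) := fun j => scalarOp X (kronCol n (Pi.single j 1)) ξ
  have hpow : Tendsto (fun r : ℂ => r ^ N) (𝓝 0) (𝓝 0) := by
    simpa [hN.ne'] using (continuous_pow N).tendsto (0 : ℂ)
  have hterm : ∀ j : Fin N, (fun r : ℂ => r ^ (j : ℕ) *
      (φ' (zeroExt F (c • W + r ^ N • D) (ξ' j)) - φ' (zeroExt F (c • W) (ξ' j))))
        =O[𝓝 0] fun r : ℂ => r ^ N := fun j => by
    obtain ⟨C, hC⟩ := hF.exists_norm_sub_le hΩ hopen hb hcW D (ξ' j) φ'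
    have h1 := (Asymptotics.IsBigO.of_bound C hC).comp_tendsto hpow
    have h2 : (fun r : ℂ => r ^ (j : ℕ)) =O[𝓝 0] fun _ : ℂ => (1 : ℂ) :=
      ((continuous_pow (j : ℕ)).tendsto (0 : ℂ)).isBigO_one ℂ
    simpa [Function.comp_def] using h2.mul h1
  have hsum : (fun r : ℂ => φ (zeroExt F ((c * r) • Z) ξ) -
      φ (partialSum ((c * r) • Z) (taylorCoeff F) N ξ)) =O[𝓝 0] fun r : ℂ => r ^ N := by
    refine (Asymptotics.IsBigO.sum (s := Finset.univ) fun j _ => hterm j).congr' ?_ .rfl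
    have hmul : Tendsto (fun r : ℂ => c * r) (𝓝 0) (𝓝 0) := by
      simpa using (continuous_const_mul c).tendsto (0 : ℂ)
    filter_upwards [hpow.eventually (hopen.eventually hcW D),
      hmul.eventually (hopen.eventually h0 Z)] with r hr1 hr2
    rw [zero_add] at hr2
    have h1 := hF.zeroExt_intertwine hr2 hr1
      (α := kronCol n fun j : Fin N => r ^ (j : ℕ)) fun k => by
        rw [hD, Pi.smul_apply, Pi.smul_apply, Matrix.smul_mul, kronTuple_mul_kronCol,
          weightedShift_mulVec_pow, kronCol_smul, Matrix.smul_mul, Matrix.mul_smul, smul_smul]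
    have h2 : scalarOp Y (kronCol n (Pi.single (⟨0, hN⟩ : Fin N) 1))ᵀ ∘L
        scalarOp Y (kronCol n fun j : Fin N => r ^ (j : ℕ)) = ContinuousLinearMap.id ℂ _ := by
      rw [← scalarOp_mul, kronCol_transpose_mul_kronCol, pow_zero, one_smul, scalarOp_one]
    have h3 : φ (zeroExt F ((c * r) • Z) ξ) =
        φ' (zeroExt F (c • W + r ^ N • D) (∑ j : Fin N, r ^ (j : ℕ) • ξ' j)) := by
      rw [← scalarOp_kronCol_apply]
      have h4 := DFunLike.congr_fun h1 ξ
      have h5 := DFunLike.congr_fun h2 (zeroExt F ((c * r) • Z) ξ)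
      simp only [ContinuousLinearMap.comp_apply, ContinuousLinearMap.id_apply] at h4 h5
      simp only [φ', ContinuousLinearMap.comp_apply]
      rw [← h4, h5]
    have h6 : φ (partialSum ((c * r) • Z) (taylorCoeff F) N ξ) =
        φ' (zeroExt F (c • W) (∑ j : Fin N, r ^ (j : ℕ) • ξ' j)) := by
      rw [← scalarOp_kronCol_apply, ← scalarOp_comp_partialSum_kronTuple hN, zeroExt_of_mem F hcW,
        hF.eq_partialSum_taylorCoeff hΩ' hN ⟨c • W, hcW⟩ fun a ha => by
          rw [wordEval_smul, hWnil a ha, smul_zero]]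
      rfl
    rw [h3, h6]
    simp only [map_sum, map_smul, smul_eq_mul, mul_sub, Finset.sum_sub_distrib, Finset.sum_apply]
  have hdiv : Tendsto (fun t : ℂ => t / c) (𝓝 0) (𝓝 0) := by
    simpa using (continuous_id.div_const c).tendsto (0 : ℂ)
  have h := hsum.comp_tendsto hdiv
  simp only [Function.comp_def, mul_div_cancel₀ _ hc, div_pow] at h
  refine h.trans ?_
  simp only [div_eq_inv_mul]
  exact Asymptotics.isBigO_const_mul_self _ _ _

omit hΩ hopen hF hb hΩ' in
/-- The coefficients of an asymptotic expansion in powers of `t` are unique. -/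
theorem eq_zero_of_sum_isBigO {c : ℕ → ℂ}
    (h : ∀ N, 0 < N → (fun t : ℂ => ∑ k ∈ Finset.range N, t ^ k * c k) =O[𝓝 0] fun t => t ^ N)
    (k : ℕ) : c k = 0 := by
  induction k using Nat.strong_induction_on with
  | _ k ih =>
    obtain ⟨C, hC⟩ := (h (k + 1) (Nat.succ_pos k)).bound
    have h1 : ∀ᶠ t : ℂ in 𝓝[≠] 0, ‖c k‖ ≤ C * ‖t‖ := by
      filter_upwards [hC.filter_mono nhdsWithin_le_nhds, self_mem_nhdsWithin] with t ht ht0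
      have h2 : ∑ j ∈ Finset.range k, t ^ j * c j = 0 :=
        Finset.sum_eq_zero fun j hj => by rw [ih j (Finset.mem_range.1 hj), mul_zero]
      rw [Finset.sum_range_succ, h2, zero_add, norm_mul, norm_pow, norm_pow, pow_succ] at ht
      have h3 : 0 < ‖t‖ ^ k := pow_pos (norm_pos_iff.2 ht0) k
      exact le_of_mul_le_mul_left (by linarith) h3
    have h2 : Tendsto (fun t : ℂ => C * ‖t‖) (𝓝[≠] 0) (𝓝 0) := by
      have : Tendsto (fun t : ℂ => C * ‖t‖) (𝓝 0) (𝓝 (C * ‖(0 : ℂ)‖)) :=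
        Continuous.tendsto (by fun_prop) _
      rw [norm_zero, mul_zero] at this
      exact this.mono_left nhdsWithin_le_nhds
    exact norm_le_zero_iff.1 (ge_of_tendsto h2 h1)

/-- A nc function that is locally bounded along slices is the sum of its Taylor series on the
circular core of its domain. -/
theorem IsNCFunction.hasSeriesSum_of_mem_circularCore {n : ℕ} (Z : Ω n)
    (hZ : Z.1 ∈ circularCore Ω n) : HasSeriesSum Z.1 (taylorCoeff F) (F n Z) := by
  rw [hasSeriesSum_iff]
  intro ξ φ
  obtain rfl | hn := Nat.eq_zero_or_pos n
  · -- At level `0` all vectors vanish.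
    have : ξ = 0 := by
      ext i
      exact i.elim0
    simp [this]
  let g : ℂ → ℂ := fun t => φ (zeroExt F (t • Z.1) ξ)
  let U : Set ℂ := {t | t • Z.1 ∈ Ω n}
  have hU : IsOpen U := by
    rw [isOpen_iff_mem_nhds]
    intro t ht
    have h1 := hopen.eventually (show t • Z.1 ∈ Ω n from ht) Z.1
    have h2 : Tendsto (fun s : ℂ => s - t) (𝓝 t) (𝓝 0) := by
      simpa using (continuous_sub_right t).tendsto t
    filter_upwards [h2.eventually h1] with s hs
    rwa [← add_smul, add_sub_cancel] at hs
  have hg : DifferentiableOn ℂ g U := fun t ht => by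
    have h1 : (0 : MatTuple d n) + t • Z.1 ∈ Ω n := by rwa [zero_add]
    have := hF.differentiableAt_slice hΩ hopen hb h1 ξ φ
    simp only [zero_add] at this
    exact this.differentiableWithinAt
  obtain ⟨δ, hδ, hsub⟩ := (isCompact_closedBall (0 : ℂ) 1).exists_thickening_subset_open hU
    fun t ht => hZ t (by simpa using ht)
  rw [thickening_closedBall hδ zero_le_one] at hsub
  let R : NNReal := ⟨1 + δ / 2, by positivity⟩
  have hR : 1 < R := by
    rw [← NNReal.coe_lt_coe]
    change 1 < 1 + δ / 2
    linarith
  have hgR : DifferentiableOn ℂ g (Metric.closedBall 0 R) := hg.mono fun t ht => hsub <| by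
    have h1 : ‖t‖ ≤ 1 + δ / 2 := by
      rw [mem_closedBall_zero_iff] at ht
      exact ht
    rw [mem_ball_zero_iff]
    linarith
  have hp := hgR.hasFPowerSeriesOnBall (zero_lt_one.trans hR)
  set p := cauchyPowerSeries g 0 R
  have hcoeff : ∀ k, p.coeff k = φ (homPart Z.1 (taylorCoeff F) k ξ) := fun k => by
    rw [← sub_eq_zero]
    refine eq_zero_of_sum_isBigO
      (c := fun k => p.coeff k - φ (homPart Z.1 (taylorCoeff F) k ξ)) (fun N hN => ?_) k
    have h1 := hp.hasFPowerSeriesAt.isBigO_sub_partialSum_pow N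
    have h2 := hF.isBigO_sub_partialSum hΩ hopen hb hΩ' hn hN Z.1 ξ φ
    have h3 : (fun t : ℂ => ‖t‖ ^ N) =O[𝓝 0] fun t : ℂ => t ^ N :=
      Asymptotics.isBigO_of_le _ fun t => by simp
    refine (h2.sub (h1.trans h3)).congr_left fun t => ?_
    simp only [FormalMultilinearSeries.partialSum, FormalMultilinearSeries.apply_eq_pow_smul_coeff,
      partialSum_eq, homPart_smul, sum_apply, map_sum, smul_apply, map_smul, smul_eq_mul, mul_sub,
      Finset.sum_sub_distrib, zero_add, g]
    ring
  have h1 := (hp.hasSum (y := 1)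
    (by simpa [Metric.mem_eball, edist_eq_enorm_sub] using hR)).tendsto_sum_nat
  simp only [FormalMultilinearSeries.apply_eq_pow_smul_coeff, one_pow, one_smul, hcoeff, zero_add,
    g, zeroExt_of_mem F Z.2] at h1
  simpa only [partialSum_eq, sum_apply, map_sum] using h1

end Taylor

/-! ### The domains of the theorem contain multiples of all nilpotent points -/

theorem directSum_zero {n m : ℕ} : directSum (0 : MatTuple d n) (0 : MatTuple d m) = 0 := by
  funext k
  simp [directSum_eq]

theorem IsNCSet.zero_mem {Ω : NCDomain d} (hΩ : IsNCSet Ω) (h0 : (0 : MatTuple d 1) ∈ Ω 1) {n : ℕ}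
    (hn : 0 < n) : (0 : MatTuple d n) ∈ Ω n := by
  induction n, hn using Nat.le_induction with
  | base => exact h0
  | succ n _ ih =>
    rw [← directSum_zero]
    exact hΩ n 1 0 0 ih h0

theorem IsFinitelyOpen.exists_smul_mem_circularCore {Ω : NCDomain d} (hopen : IsFinitelyOpen Ω)
    {n : ℕ} (h0 : (0 : MatTuple d n) ∈ Ω n) (Z : MatTuple d n) :
    ∃ t : ℂ, t ≠ 0 ∧ t • Z ∈ circularCore Ω n := by
  obtain ⟨ε, hε, h⟩ := hopen n 0 h0 Z
  refine ⟨((ε / 2 : ℝ) : ℂ), by exact_mod_cast (half_pos hε).ne', fun s hs => ?_⟩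
  rw [smul_smul, ← zero_add ((s * _) • Z)]
  refine h _ ?_
  rw [norm_mul, Complex.norm_real, Real.norm_eq_abs, abs_of_pos (half_pos hε)]
  nlinarith [norm_nonneg s]

theorem IsFinitelyOpen.absorbsNilp_circularCore {Ω : NCDomain d} (hopen : IsFinitelyOpen Ω)
    (hΩ : IsNCSet Ω) (h0 : (0 : MatTuple d 1) ∈ Ω 1) : AbsorbsNilp (circularCore Ω) :=
  fun _ hn Z _ => hopen.exists_smul_mem_circularCore (hΩ.zero_mem h0 hn) Z

theorem AbsorbsNilp.mono {Ω Ω' : NCDomain d} (h : AbsorbsNilp Ω') (hsub : ∀ n, Ω' n ⊆ Ω n) :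
    AbsorbsNilp Ω :=
  fun n hn Z hZ => (h n hn Z hZ).imp fun _ ht => ⟨ht.1, hsub n ht.2⟩

theorem absorbsNilp_nilp : AbsorbsNilp (Nilp d) :=
  fun _ _ Z hZ => ⟨1, one_ne_zero, by rwa [one_smul]⟩

theorem nilp_subset_convSet (T : FormalSeries d (X →L[ℂ] Y)) (n : ℕ) : Nilp d n ⊆ convSet T n := by
  rintro Z ⟨N, hN⟩
  refine ⟨partialSum Z T N, hasSeriesSum_of_eventually_eq N fun M hM => ?_⟩
  rw [partialSum_eq, partialSum_eq]
  refine (Finset.sum_subset (Finset.range_mono hM) fun ℓ _ hℓ => ?_).symm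
  refine Finset.sum_eq_zero fun b _ => ?_
  rw [hN _ (by simpa using hℓ), tensorOp_zero_left]

theorem isSliceBounded_of_isLocallyBoundedAlongSlices [CompleteSpace X] [CompleteSpace Y]
    {Ω : NCDomain d}
    {H : NCMap Ω X Y} (hb : IsLocallyBoundedAlongSlices (kolmogorovKernel H)) :
    IsSliceBounded H := by
  intro n Z hZ D ξ φ
  obtain ⟨ε, hε, C, h⟩ := hb n Z hZ D
  refine ⟨‖φ‖ * (√C * ‖ξ‖), ?_⟩
  rw [Metric.eventually_nhds_iff]
  refine ⟨ε, hε, fun t ht => ?_⟩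
  obtain ⟨hmem, hC⟩ := h t (by simpa using ht)
  rw [← norm_sq_eq_norm_kolmogorovKernel] at hC
  rw [zeroExt_of_mem H hmem]
  refine (φ.le_opNorm _).trans (mul_le_mul_of_nonneg_left ?_ (norm_nonneg _))
  refine ((H n ⟨_, hmem⟩).le_opNorm ξ).trans (mul_le_mul_of_nonneg_right ?_ (norm_nonneg _))
  exact Real.le_sqrt_of_sq_le hC

theorem IsSliceBounded.comp_colOp {Ω : NCDomain d} {H : NCMap Ω X Y} (hb : IsSliceBounded H)
    (x : X) : IsSliceBounded (Ω := Ω) (X := ℂ) (Y := Y) fun n Z => H n Z ∘L colOp n x := by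
  intro n Z hZ D ξ φ
  obtain ⟨C, hC⟩ := hb n Z hZ D (colOp n x ξ) φ
  refine ⟨C, hC.mono fun t ht => ?_⟩
  convert ht using 3
  by_cases hmem : Z + t • D ∈ Ω n
  · rw [zeroExt_of_mem _ hmem, zeroExt_of_mem _ hmem, ContinuousLinearMap.comp_apply]
  · rw [zeroExt, dif_neg hmem, zeroExt, dif_neg hmem]
    simp

/-! ### The identity theorem -/

/-- The identity theorem for functions that are analytic along complex lines. -/
theorem eqOn_zero_of_differentiable_slices {E : Type*} [NormedAddCommGroup E] [NormedSpace ℂ E]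
    {U : Set E} (hU : IsOpen U) (hc : IsPreconnected U) {f : E → ℂ}
    (hf : ∀ (z D : E) (t : ℂ), z + t • D ∈ U → DifferentiableAt ℂ (fun s : ℂ => f (z + s • D)) t)
    {x₀ : E} (hx₀ : x₀ ∈ U) (h0 : ∀ᶠ x in 𝓝 x₀, f x = 0) {x : E} (hx : x ∈ U) : f x = 0 := by
  let A : Set E := {x | ∀ᶠ y in 𝓝 x, f y = 0}
  have hA : IsOpen A := isOpen_setOfPred_eventually_nhds
  have hsub : U ⊆ A := by
    refine hc.subset_of_closure_inter_subset hA ⟨x₀, hx₀, h0⟩ ?_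
    rintro x ⟨hxA, hxU⟩
    obtain ⟨r, hr, hball⟩ := Metric.isOpen_iff.1 hU x hxU
    obtain ⟨y, hyA, hy⟩ := Metric.mem_closure_iff.1 hxA r hr
    refine Filter.mem_of_superset (Metric.ball_mem_nhds x hr) fun w hw => ?_
    -- The complex line through `y` and `w` meets the ball in a connected set.
    let L : ℂ → E := fun t => y + t • (w - y)
    have hL : Continuous L := by fun_prop
    have hVopen : IsOpen (L ⁻¹' Metric.ball x r) := Metric.isOpen_ball.preimage hL
    have hVconv : Convex ℝ (L ⁻¹' Metric.ball x r) := by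
      intro t ht s hs a b ha hb hab
      have h1 := convex_ball x r ht hs ha hb hab
      have h2 : L (a • t + b • s) = a • L t + b • L s := by
        simp only [L, smul_add, add_smul, smul_assoc]
        have : y = a • y + b • y := by rw [← add_smul, hab, one_smul]
        nth_rewrite 1 [this]
        abel
      rwa [Set.mem_preimage, h2]
    have han : AnalyticOnNhd ℂ (fun t => f (L t)) (L ⁻¹' Metric.ball x r) :=
      DifferentiableOn.analyticOnNhd
        (fun t ht => (hf y (w - y) t (hball ht)).differentiableWithinAt) hVopen
    have hy0 : L 0 = y := by simp [L]
    have hw1 : L 1 = w := by simp [L]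
    have hev : (fun t => f (L t)) =ᶠ[𝓝 0] 0 := by
      have : Tendsto L (𝓝 0) (𝓝 y) := by simpa [hy0] using hL.tendsto 0
      exact this.eventually hyA
    have := han.eqOn_zero_of_preconnected_of_eventuallyEq_zero hVconv.isPreconnected
      (by rw [Set.mem_preimage, hy0, Metric.mem_ball']; rwa [dist_comm] at hy ⊢) hev
      (show (1 : ℂ) ∈ L ⁻¹' Metric.ball x r by rwa [Set.mem_preimage, hw1])
    simpa [hw1] using this
  exact (hsub hx).self_of_nhds

/-- If all levels of `Ω` are open and connected, a nc function that is locally bounded along slices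
and vanishes on the circular core vanishes identically. -/
theorem IsNCFunction.eq_zero_of_circularCore {Ω : NCDomain d} (hΩ : IsNCSet Ω)
    (hopen : IsFinitelyOpen Ω) (h0 : (0 : MatTuple d 1) ∈ Ω 1)
    (hconn : ∀ n, IsOpen (Ω n) ∧ IsPreconnected (Ω n)) {F : NCMap Ω X Y} (hF : IsNCFunction F)
    (hb : IsSliceBounded F) (h : ∀ (n : ℕ) (Z : Ω n), Z.1 ∈ circularCore Ω n → F n Z = 0)
    (n : ℕ) (Z : Ω n) : F n Z = 0 := by
  ext1 ξ
  refine (SeparatingDual.eq_iff_forall_dual_eq (R := ℂ)).2 fun φ => ?_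
  obtain rfl | hn := Nat.eq_zero_or_pos n
  · have : ξ = 0 := by
      ext i
      exact i.elim0
    simp [this]
  -- A neighbourhood of `0` lies in the circular core.
  have hcore : ∀ᶠ W : MatTuple d n in 𝓝 0, W ∈ circularCore Ω n := by
    have hmem := (hconn n).1.mem_nhds (hΩ.zero_mem h0 hn)
    exact Filter.mem_of_superset (balancedCore_mem_nhds_zero (𝕜 := ℂ) hmem) fun W hW t ht =>
      balancedCore_subset _ (balancedCore_balanced (𝕜 := ℂ) (Ω n) t ht ⟨W, hW, rfl⟩)
  have := eqOn_zero_of_differentiable_slices (E := Fin d → Fin n → Fin n → ℂ)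
    (f := fun W => φ (zeroExt F (n := n) W ξ)) (hconn n).1 (hconn n).2
    (fun z D t ht => hF.differentiableAt_slice hΩ hopen hb ht ξ φ) (hΩ.zero_mem h0 hn)
    (hcore.mono fun W hW => by
      rw [zeroExt_of_mem F (circularCore_subset Ω n hW), h n _ hW]
      simp) Z.2
  simpa [zeroExt_of_mem F Z.2] using this

/-! ### The convergence set of a formal series -/

theorem isNCFunction_sumMap (Hf : FormalSeries d (X →L[ℂ] Y)) : IsNCFunction (sumMap Hf) :=
  fun _ _ Z Z' _ h =>
    (hasSeriesSum_seriesSum Z.2).intertwine (hasSeriesSum_seriesSum Z'.2) h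

theorem isNCSet_convSet (Hf : FormalSeries d (X →L[ℂ] Y)) : IsNCSet (convSet Hf) := by
  rintro n m Z W ⟨S, hS⟩ ⟨S', hS'⟩
  refine ⟨scalarOp Y (inlMat n m) ∘L S ∘L scalarOp X (inlMat n m)ᵀ +
    scalarOp Y (inrMat n m) ∘L S' ∘L scalarOp X (inrMat n m)ᵀ, ?_⟩
  rw [hasSeriesSum_iff] at hS hS' ⊢
  intro ξ φ
  have h1 : ∀ k, inlMat n m * Z k = directSum Z W k * inlMat n m := fun k => by
    simp only [directSum_eq, Matrix.add_mul, Matrix.mul_assoc, inlMat_mul_inlMat,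
      inrMat_mul_inlMat, Matrix.mul_zero, Matrix.mul_one, add_zero]
  have h2 : ∀ k, inrMat n m * W k = directSum Z W k * inrMat n m := fun k => by
    simp only [directSum_eq, Matrix.add_mul, Matrix.mul_assoc, inlMat_mul_inrMat,
      inrMat_mul_inrMat, Matrix.mul_zero, Matrix.mul_one, zero_add]
  have h3 : scalarOp X (inlMat n m) (scalarOp X (inlMat n m)ᵀ ξ) +
      scalarOp X (inrMat n m) (scalarOp X (inrMat n m)ᵀ ξ) = ξ := by
    have h := DFunLike.congr_fun (congrArg (scalarOp X) (inlMat_add_inrMat n m)) ξ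
    rwa [scalarOp_add, scalarOp_mul, scalarOp_mul, scalarOp_one] at h
  have h4 := (hS (scalarOp X (inlMat n m)ᵀ ξ) (φ ∘L scalarOp Y (inlMat n m))).add
    (hS' (scalarOp X (inrMat n m)ᵀ ξ) (φ ∘L scalarOp Y (inrMat n m)))
  simp only [add_apply, ContinuousLinearMap.comp_apply, map_add] at h4 ⊢
  refine h4.congr fun N => ?_
  have h5 := DFunLike.congr_fun (scalarOp_comp_partialSum h1 Hf N) (scalarOp X (inlMat n m)ᵀ ξ)
  have h6 := DFunLike.congr_fun (scalarOp_comp_partialSum h2 Hf N) (scalarOp X (inrMat n m)ᵀ ξ)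
  simp only [ContinuousLinearMap.comp_apply] at h5 h6
  rw [h5, h6, ← map_add, ← map_add, h3]

/-- If all the series `∑ Z^a ⊗ T_a x` converge, then the series `∑ Z^a ⊗ T_a` converges. The sum is
a bounded operator by the uniform boundedness principle and the closed graph theorem. -/
theorem exists_hasSeriesSum_of_forall [CompleteSpace X] [CompleteSpace Y] {n : ℕ}
    {Z : MatTuple d n} {T : FormalSeries d (X →L[ℂ] Y)}
    (h : ∀ x, ∃ S, HasSeriesSum Z (vecSeries fun a => T a x) S) : ∃ S, HasSeriesSum Z T S := by
  choose S hS using h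
  let B : Amp X n → Amp Y n := fun ξ => ∑ j, S (ξ j) (EuclideanSpace.single j 1)
  have hB : ∀ (ξ : Amp X n) (φ : StrongDual ℂ (Amp Y n)),
      Tendsto (fun N => φ (partialSum Z T N ξ)) atTop (𝓝 (φ (B ξ))) := fun ξ φ => by
    have h1 := tendsto_finsetSum Finset.univ fun j _ =>
      hasSeriesSum_iff.1 (hS (ξ j)) (EuclideanSpace.single j 1) φ
    simp only [← partialSum_comp_colOp, ContinuousLinearMap.comp_apply] at h1
    simp only [← map_sum, sum_colOp_single] at h1
    exact h1
  have hext : ∀ y y' : Amp Y n, (∀ φ : StrongDual ℂ (Amp Y n), φ y = φ y') → y = y' :=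
    fun y y' => (SeparatingDual.eq_iff_forall_dual_eq (R := ℂ)).2
  let B' : Amp X n →ₗ[ℂ] Amp Y n :=
    { toFun := B
      map_add' := fun ξ η => hext _ _ fun φ => by
        refine tendsto_nhds_unique (hB (ξ + η) φ) ?_
        simpa only [map_add] using (hB ξ φ).add (hB η φ)
      map_smul' := fun c ξ => hext _ _ fun φ => by
        refine tendsto_nhds_unique (hB (c • ξ) φ) ?_
        simpa only [map_smul, RingHom.id_apply] using (hB ξ φ).const_smul c }
  have hcont : ∀ φ : StrongDual ℂ (Amp Y n), Continuous fun ξ => φ (B ξ) := fun φ =>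
    (continuousLinearMapOfTendsto (fun N => φ ∘L partialSum Z T N)
      (f := fun ξ => φ (B ξ)) (tendsto_pi_nhds.2 fun ξ => hB ξ φ)).continuous
  have hBcont : Continuous B' := by
    refine LinearMap.continuous_of_seq_closed_graph (g := B') fun u x y hu hy =>
      hext _ _ fun φ => ?_
    exact tendsto_nhds_unique ((φ.continuous.tendsto y).comp hy) (((hcont φ).tendsto x).comp hu)
  exact ⟨⟨B', hBcont⟩, hasSeriesSum_iff.2 hB⟩

/-! ### Formal and nc reproducing kernel Hilbert spaces -/

theorem taylorCoeff_eq_of_hasSeriesSum {Ω : NCDomain d} (hΩ : AbsorbsNilp Ω) {F : NCMap Ω X Y}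
    {T : FormalSeries d (X →L[ℂ] Y)} (hT : ∀ (n : ℕ) (Z : Ω n), HasSeriesSum Z.1 T (F n Z)) :
    taylorCoeff F = T := by
  funext a
  have h := hΩ.bidiagonal a
  rw [taylorCoeff, dif_pos h, (hT _ ⟨_, h.choose_spec.2⟩).blockEntry_bidiagonal, smul_smul,
    inv_mul_cancel₀ (pow_ne_zero _ h.choose_spec.1), one_smul]

theorem taylorCoeff_comp_colOp {Ω : NCDomain d} (H : NCMap Ω X Y) (x : X) (a : Word d) :
    taylorCoeff (Ω := Ω) (fun n Z => H n Z ∘L colOp n x) a 1 = taylorCoeff H a x := by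
  simp only [taylorCoeff]
  split_ifs
  · rw [smul_apply, smul_apply, blockEntry_comp_colOp]
  · rfl

section FormalSpace

variable [CompleteSpace X] [CompleteSpace Y] {Ω : NCDomain d} {H : NCMap Ω X Y}
variable {T : FormalSeries d (X →L[ℂ] Y)}
variable {𝓕 : Type*} [NormedAddCommGroup 𝓕] [InnerProductSpace ℂ 𝓕] [CompleteSpace 𝓕]
  [RKHS ℂ 𝓕 (Word d) Y]

omit [CompleteSpace X] [CompleteSpace Y] [CompleteSpace 𝓕] in
/-- The elements of the formal space, regarded as the functions `∑ Z^a u ⊗ f_a` on `Ω`, are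
determined by their values at nilpotent points. -/
theorem eq_of_comp_colOp_eq (hΩ : AbsorbsNilp Ω)
    (hT : ∀ (n : ℕ) (Z : Ω n), HasSeriesSum Z.1 T (H n Z)) {V : 𝓕 →ₗᵢ[ℂ] X}
    (hV : ∀ (f : 𝓕) (a : Word d), f a = T a (V f)) {f g : 𝓕}
    (h : ∀ (n : ℕ) (Z : Ω n), H n Z ∘L colOp n (V f) = H n Z ∘L colOp n (V g)) : f = g := by
  refine RKHS.ext fun a => ?_
  rw [hV, hV, ← taylorCoeff_eq_of_hasSeriesSum hΩ hT, ← taylorCoeff_comp_colOp,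
    ← taylorCoeff_comp_colOp H (V g)]
  simp only [h]

omit [CompleteSpace Y] in
theorem isCarrier_of_adj_apply (hT : ∀ (n : ℕ) (Z : Ω n), HasSeriesSum Z.1 T (H n Z))
    {V : 𝓕 →ₗᵢ[ℂ] X} (hV : ∀ (f : 𝓕) (a : Word d), f a = T a (V f))
    (hV' : ∀ (x : X) (a : Word d), (V.adj x) a = T a x) : IsCarrier H V := fun x n Z => by
  have h1 := (hT n Z).comp_colOp (V (V.adj x))
  simp only [← hV, hV'] at h1
  exact h1.unique ((hT n Z).comp_colOp x)

/-- The formal reproducing kernel Hilbert space of `T(z) T(w)^*` is, as a space of functions, the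
reproducing kernel Hilbert space of the kernel of the sum `H` of the series `T`. -/
theorem isNCRKHS_seriesSum (hH : IsNCFunction H) (hΩ : AbsorbsNilp Ω)
    (hT : ∀ (n : ℕ) (Z : Ω n), HasSeriesSum Z.1 T (H n Z))
    (hker : RKHS.kernel 𝓕 = formalKolmogorov T) :
    IsNCRKHS (kolmogorovKernel H) 𝓕
      (fun f n Z => seriesSum Z.1 (vecSeries (f : Word d → Y))) := by
  obtain ⟨V, hV, hV'⟩ := RKHS.exists_isometry 𝓕 T fun a b => by rw [hker]; rfl
  have hev : ∀ (f : 𝓕) (n : ℕ) (Z : Ω n),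
      seriesSum Z.1 (vecSeries (f : Word d → Y)) = H n Z ∘L colOp n (V f) := fun f n Z => by
    have h1 := (hT n Z).comp_colOp (V f)
    simp only [← hV] at h1
    exact h1.seriesSum_eq
  refine (isCarrier_of_adj_apply hT hV hV').isNCRKHS hH hev fun f g hfg => ?_
  refine eq_of_comp_colOp_eq hΩ hT hV fun n Z => ?_
  rw [← hev, ← hev]
  exact congrFun (congrFun hfg n) Z

/-- Passing to the Taylor series is a unitary map of the reproducing kernel Hilbert space of `H` onto
the formal reproducing kernel Hilbert space of its Taylor series. -/
theorem IsNCRKHS.exists_taylor_equiv (hΩ : AbsorbsNilp Ω)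
    (hT : ∀ (n : ℕ) (Z : Ω n), HasSeriesSum Z.1 T (H n Z))
    (hker : RKHS.kernel 𝓕 = formalKolmogorov T)
    {𝓚 : Type*} [NormedAddCommGroup 𝓚] [InnerProductSpace ℂ 𝓚] [CompleteSpace 𝓚]
    {ev : 𝓚 → NCMap Ω ℂ Y} (hev : IsNCRKHS (kolmogorovKernel H) 𝓚 ev) :
    ∃ U : 𝓚 ≃ₗᵢ[ℂ] 𝓕, ∀ g : 𝓚, (∀ a : Word d, U g a = taylorCoeff (ev g) a 1) ∧
      ∀ (n : ℕ) (Z : Ω n), HasSeriesSum Z.1 (vecSeries (U g : Word d → Y)) (ev g n Z) := by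
  obtain ⟨V, hV, hV'⟩ := RKHS.exists_isometry 𝓕 T fun a b => by rw [hker]; rfl
  obtain ⟨W, hW, hW'⟩ := hev.exists_isCarrier
  obtain ⟨U, hU⟩ := hW.exists_linearIsometryEquiv (isCarrier_of_adj_apply hT hV hV')
    (fun f g h => hev.ev_injective <| by
      funext n Z
      rw [hW', hW', h])
    (fun f g h => eq_of_comp_colOp_eq hΩ hT hV h)
  refine ⟨U, fun g => ⟨fun a => ?_, fun n Z => ?_⟩⟩
  · have h1 : ev g = fun n Z => H n Z ∘L colOp n (W g) := by
      funext n Z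
      exact hW' g n Z
    rw [h1, taylorCoeff_comp_colOp, hU, hV', taylorCoeff_eq_of_hasSeriesSum hΩ hT]
  · have h1 := (hT n Z).comp_colOp (W g)
    simp only [← hV', ← hU] at h1
    rwa [hW']

theorem convSet_eq_spaceConvSet (hker : RKHS.kernel 𝓕 = formalKolmogorov T) :
    convSet T = spaceConvSet 𝓕 := by
  obtain ⟨V, hV, hV'⟩ := RKHS.exists_isometry 𝓕 T fun a b => by rw [hker]; rfl
  funext n
  ext Z
  refine ⟨fun ⟨S, hS⟩ f => ⟨S ∘L colOp n (V f), ?_⟩,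
    fun h => exists_hasSeriesSum_of_forall fun x => ?_⟩
  · have h1 := hS.comp_colOp (V f)
    simp only [← hV] at h1
    exact h1
  · have h1 := h (V.adj x)
    have h2 : ((V.adj x : 𝓕) : Word d → Y) = fun a => T a x := funext fun a => hV' x a
    rwa [h2] at h1

/-- Passing to the Taylor series is a coisometry of the reproducing kernel Hilbert space of `H` onto
the formal space of its Taylor series when `H` is the sum of this series on the circular core; it is
an isometry when the levels of the domain are open and connected. -/
theorem IsNCRKHS.exists_taylor_coisometry (hΩ : IsNCSet Ω) (hopen : IsFinitelyOpen Ω)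
    (h0 : (0 : MatTuple d 1) ∈ Ω 1) (hH : IsNCFunction H) (hb : IsSliceBounded H)
    (hker : RKHS.kernel 𝓕 = formalKolmogorov (taylorCoeff H))
    {𝓚 : Type*} [NormedAddCommGroup 𝓚] [InnerProductSpace ℂ 𝓚] [CompleteSpace 𝓚]
    {ev : 𝓚 → NCMap Ω ℂ Y} (hev : IsNCRKHS (kolmogorovKernel H) 𝓚 ev) :
    ∃ U : 𝓚 →L[ℂ] 𝓕, U ∘L U.adjoint = ContinuousLinearMap.id ℂ 𝓕 ∧
      (∀ g : 𝓚, (∀ a : Word d, U g a = taylorCoeff (ev g) a 1) ∧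
        ∀ (n : ℕ) (Z : Ω n), Z.1 ∈ circularCore Ω n →
          HasSeriesSum Z.1 (vecSeries (U g : Word d → Y)) (ev g n Z)) ∧
      ((∀ n, IsOpen (Ω n) ∧ IsPreconnected (Ω n)) → ∀ g : 𝓚, ‖U g‖ = ‖g‖) := by
  have hΩ' : AbsorbsNilp Ω :=
    (hopen.absorbsNilp_circularCore hΩ h0).mono (circularCore_subset Ω)
  have hT : ∀ (n : ℕ) (Z : Ω n), Z.1 ∈ circularCore Ω n →
      HasSeriesSum Z.1 (taylorCoeff H) (H n Z) := fun n Z hZ =>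
    hH.hasSeriesSum_of_mem_circularCore hΩ hopen hb hΩ' Z hZ
  obtain ⟨V, hV, hV'⟩ := RKHS.exists_isometry 𝓕 (taylorCoeff H) fun a b => by rw [hker]; rfl
  obtain ⟨W, hW, hW'⟩ := hev.exists_isCarrier
  have hevW : ∀ g, ev g = fun n Z => H n Z ∘L colOp n (W g) := fun g => by
    funext n Z
    exact hW' g n Z
  let U : 𝓚 →L[ℂ] 𝓕 := V.adj ∘L W.toContinuousLinearMap
  have hUadj : U.adjoint = W.adj ∘L V.toContinuousLinearMap := by
    rw [ContinuousLinearMap.adjoint_comp, ContinuousLinearMap.adjoint_adjoint]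
  have hUU : ∀ f, U (U.adjoint f) = f := fun f => RKHS.ext fun a => by
    rw [hUadj]
    change (V.adj (W (W.adj (V f)))) a = f a
    rw [hV', hV, ← taylorCoeff_comp_colOp, ← taylorCoeff_comp_colOp H (V f)]
    simp only [hW (V f) _]
  refine ⟨U, ContinuousLinearMap.ext hUU, fun g => ⟨fun a => ?_, fun n Z hZ => ?_⟩,
    fun hconn g => ?_⟩
  · rw [hevW, taylorCoeff_comp_colOp]
    exact hV' _ _
  · have h1 := (hT n Z hZ).comp_colOp (W g)
    simp only [← hV'] at h1
    rwa [hW']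
  · -- A function in the kernel vanishes on the circular core, hence everywhere.
    have hinj : ∀ g, U g = 0 → g = 0 := fun g hg => by
      have h1 : ∀ (n : ℕ) (Z : Ω n), ev g n Z = 0 := by
        refine IsNCFunction.eq_zero_of_circularCore hΩ hopen h0 hconn (hev.isNCFunction g) ?_
          fun n Z hZ => ?_
        · rw [hevW]
          exact hb.comp_colOp (W g)
        · have h2 := (hT n Z hZ).comp_colOp (V (V.adj (W g)))
          simp only [← hV, hV'] at h2
          have h3 := ((hT n Z hZ).comp_colOp (W g)).unique h2
          rw [hW', h3, show V.adj (W g) = 0 from hg, map_zero]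
          rw [colOp_zero, ContinuousLinearMap.comp_zero]
      refine hev.ev_injective ?_
      funext n Z
      rw [h1, hW' 0, map_zero, colOp_zero, ContinuousLinearMap.comp_zero]
    have h3 : U.adjoint (U g) = g := by
      rw [← sub_eq_zero]
      refine hinj _ ?_
      rw [map_sub, hUU, sub_self]
    rw [@norm_eq_sqrt_re_inner ℂ, @norm_eq_sqrt_re_inner ℂ _ _ _ _ g,
      ← ContinuousLinearMap.adjoint_inner_right, h3]

end FormalSpace

end NCKernels

/-! ### Taylor series and reproducing kernel Hilbert spaces -/

theorem theorem3p9 (d : ℕ)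
    (X : Type*) [NormedAddCommGroup X] [InnerProductSpace ℂ X] [CompleteSpace X]
    (Y : Type*) [NormedAddCommGroup Y] [InnerProductSpace ℂ Y] [CompleteSpace Y] :
    -- From formal positive kernels to cp nc kernels.
    (∀ (Kf : FormalKernel d Y) (Hf : FormalSeries d (X →L[ℂ] Y)),
      IsPositiveFormalKernel Kf → Kf = formalKolmogorov Hf →
      IsNCSet (convSet Hf) ∧
      IsCPNCKernel (kolmogorovKernel (sumMap Hf)) ∧
      -- `𝓕` is the formal reproducing kernel Hilbert space of `Kf`
      ∀ (𝓕 : Type*) [NormedAddCommGroup 𝓕] [InnerProductSpace ℂ 𝓕] [CompleteSpace 𝓕]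
        [RKHS ℂ 𝓕 (Word d) Y], RKHS.kernel 𝓕 = Kf →
        convSet Hf = spaceConvSet 𝓕 ∧
        IsNCRKHS (kolmogorovKernel (sumMap Hf)) 𝓕
          (fun f n Z => seriesSum Z.1 (vecSeries (f : Word d → Y))) ∧
        -- `𝓚` is the nc reproducing kernel Hilbert space of the induced kernel
        ∀ (𝓚 : Type*) [NormedAddCommGroup 𝓚] [InnerProductSpace ℂ 𝓚] [CompleteSpace 𝓚]
          (ev : 𝓚 → NCMap (convSet Hf) ℂ Y), IsNCRKHS (kolmogorovKernel (sumMap Hf)) 𝓚 ev →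
          ∃ U : 𝓕 ≃ₗᵢ[ℂ] 𝓚, ∀ (f : 𝓕) (n : ℕ) (Z : convSet Hf n),
            HasSeriesSum Z.1 (vecSeries (f : Word d → Y)) (ev (U f) n Z)) ∧
    -- The converse on the jointly nilpotent tuples.
    (∀ (K : NCKernel (Nilp d) Y) (H : NCMap (Nilp d) X Y),
      IsCPNCKernel K → IsNCFunction H → K = kolmogorovKernel H →
      (∀ (n : ℕ) (Z : Nilp d n), HasSeriesSum Z.1 (taylorCoeff H) (H n Z)) ∧
      IsPositiveFormalKernel (formalKolmogorov (taylorCoeff H)) ∧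
      (∀ n, Nilp d n ⊆ convSet (taylorCoeff H) n) ∧
      ∀ (𝓕 : Type*) [NormedAddCommGroup 𝓕] [InnerProductSpace ℂ 𝓕] [CompleteSpace 𝓕]
        [RKHS ℂ 𝓕 (Word d) Y], RKHS.kernel 𝓕 = formalKolmogorov (taylorCoeff H) →
        IsNCRKHS K 𝓕 (fun f n Z => seriesSum Z.1 (vecSeries (f : Word d → Y))) ∧
        ∀ (𝓚 : Type*) [NormedAddCommGroup 𝓚] [InnerProductSpace ℂ 𝓚] [CompleteSpace 𝓚]
          (ev : 𝓚 → NCMap (Nilp d) ℂ Y), IsNCRKHS K 𝓚 ev →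
          ∃ T : 𝓚 ≃ₗᵢ[ℂ] 𝓕, ∀ g : 𝓚,
            (∀ a : Word d, T g a = taylorCoeff (ev g) a 1) ∧
            ∀ (n : ℕ) (Z : Nilp d n),
              HasSeriesSum Z.1 (vecSeries (T g : Word d → Y)) (ev g n Z)) ∧
    -- The converse on finitely open nc sets containing `0`.
    (∀ (Ω : NCDomain d), IsNCSet Ω → IsFinitelyOpen Ω → (0 : MatTuple d 1) ∈ Ω 1 →
      ∀ (K : NCKernel Ω Y) (H : NCMap Ω X Y),
      IsCPNCKernel K → IsLocallyBoundedAlongSlices K → IsNCFunction H →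
      K = kolmogorovKernel H →
      (∀ (n : ℕ) (Z : Ω n), Z.1 ∈ circularCore Ω n →
        HasSeriesSum Z.1 (taylorCoeff H) (H n Z)) ∧
      IsPositiveFormalKernel (formalKolmogorov (taylorCoeff H)) ∧
      (∀ n, circularCore Ω n ⊆ convSet (taylorCoeff H) n) ∧
      ∀ (𝓕 : Type*) [NormedAddCommGroup 𝓕] [InnerProductSpace ℂ 𝓕] [CompleteSpace 𝓕]
        [RKHS ℂ 𝓕 (Word d) Y], RKHS.kernel 𝓕 = formalKolmogorov (taylorCoeff H) →
        -- `H(Kf)` is isometrically the space of the restriction of `K` to the circular core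
        IsNCRKHS (restrictKernel (circularCore_subset Ω) K) 𝓕
          (fun f n Z => seriesSum Z.1 (vecSeries (f : Word d → Y))) ∧
        (∀ (𝓚 : Type*) [NormedAddCommGroup 𝓚] [InnerProductSpace ℂ 𝓚] [CompleteSpace 𝓚]
          (ev : 𝓚 → NCMap (circularCore Ω) ℂ Y),
          IsNCRKHS (restrictKernel (circularCore_subset Ω) K) 𝓚 ev →
          ∃ T : 𝓚 ≃ₗᵢ[ℂ] 𝓕, ∀ g : 𝓚,
            (∀ a : Word d, T g a = taylorCoeff (ev g) a 1) ∧
            ∀ (n : ℕ) (Z : circularCore Ω n),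
              HasSeriesSum Z.1 (vecSeries (T g : Word d → Y)) (ev g n Z)) ∧
        -- passing to the Taylor series maps `H(K)` coisometrically onto `H(Kf)`, and isometrically
        -- when the levels of `Ω` are open and connected
        ∀ (𝓚 : Type*) [NormedAddCommGroup 𝓚] [InnerProductSpace ℂ 𝓚] [CompleteSpace 𝓚]
          (ev : 𝓚 → NCMap Ω ℂ Y), IsNCRKHS K 𝓚 ev →
          ∃ T : 𝓚 →L[ℂ] 𝓕,
            T ∘L T.adjoint = ContinuousLinearMap.id ℂ 𝓕 ∧
            (∀ g : 𝓚,
              (∀ a : Word d, T g a = taylorCoeff (ev g) a 1) ∧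
              ∀ (n : ℕ) (Z : Ω n), Z.1 ∈ circularCore Ω n →
                HasSeriesSum Z.1 (vecSeries (T g : Word d → Y)) (ev g n Z)) ∧
            ((∀ n, IsOpen (Ω n) ∧ IsPreconnected (Ω n)) → ∀ g : 𝓚, ‖T g‖ = ‖g‖)) := by
  refine ⟨?_, ?_, ?_⟩
  · intro Kf Hf _ hKf
    refine ⟨isNCSet_convSet Hf, (isNCFunction_sumMap Hf).isCPNCKernel, ?_⟩
    intro 𝓕 _ _ _ _ hker
    rw [hKf] at hker
    have hΩ : AbsorbsNilp (convSet Hf) := absorbsNilp_nilp.mono (nilp_subset_convSet Hf)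
    have hT : ∀ (n : ℕ) (Z : convSet Hf n), HasSeriesSum Z.1 Hf (sumMap Hf n Z) := fun _ Z =>
      hasSeriesSum_seriesSum Z.2
    refine ⟨convSet_eq_spaceConvSet hker,
      isNCRKHS_seriesSum (isNCFunction_sumMap Hf) hΩ hT hker, ?_⟩
    intro 𝓚 _ _ _ ev hev
    obtain ⟨U, hU⟩ := hev.exists_taylor_equiv hΩ hT hker
    refine ⟨U.symm, fun f n Z => ?_⟩
    simpa using (hU (U.symm f)).2 n Z
  · intro K H _ hH hKH
    subst hKH
    have hT : ∀ (n : ℕ) (Z : Nilp d n), HasSeriesSum Z.1 (taylorCoeff H) (H n Z) := fun _ Z =>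
      hH.hasSeriesSum_of_mem_nilp absorbsNilp_nilp Z Z.2
    refine ⟨hT, isPositiveFormalKernel_formalKolmogorov _, fun n => nilp_subset_convSet _ n, ?_⟩
    intro 𝓕 _ _ _ _ hker
    exact ⟨isNCRKHS_seriesSum hH absorbsNilp_nilp hT hker, fun 𝓚 _ _ _ ev hev =>
      hev.exists_taylor_equiv absorbsNilp_nilp hT hker⟩
  · intro Ω hΩ hopen h0 K H _ hb hH hKH
    subst hKH
    have hb' : IsSliceBounded H := isSliceBounded_of_isLocallyBoundedAlongSlices hb
    have hcore : AbsorbsNilp (circularCore Ω) := hopen.absorbsNilp_circularCore hΩ h0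
    have hT : ∀ (n : ℕ) (Z : Ω n), Z.1 ∈ circularCore Ω n →
        HasSeriesSum Z.1 (taylorCoeff H) (H n Z) := fun _ Z hZ =>
      hH.hasSeriesSum_of_mem_circularCore hΩ hopen hb' (hcore.mono (circularCore_subset Ω)) Z hZ
    -- The restriction of `H` to the circular core factors the restricted kernel.
    let Hc : NCMap (circularCore Ω) X Y := fun n Z => H n ⟨Z.1, circularCore_subset Ω n Z.2⟩
    have hHc : IsNCFunction Hc := fun n m Z Z' α h => hH n m _ _ α h
    have hTc : ∀ (n : ℕ) (Z : circularCore Ω n),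
        HasSeriesSum Z.1 (taylorCoeff H) (Hc n Z) := fun n Z => hT n ⟨Z.1, _⟩ Z.2
    refine ⟨hT, isPositiveFormalKernel_formalKolmogorov _, fun n Z hZ => ⟨_, hTc n ⟨Z, hZ⟩⟩, ?_⟩
    intro 𝓕 _ _ _ _ hker
    exact ⟨isNCRKHS_seriesSum hHc hcore hTc hker,
      fun 𝓚 _ _ _ ev hev => IsNCRKHS.exists_taylor_equiv (H := Hc) hcore hTc hker hev,
      fun 𝓚 _ _ _ ev hev => hev.exists_taylor_coisometry hΩ hopen h0 hH hb' hker⟩
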